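/- Let $n\ge 0$. A *unitrivalent graph* is a finite graph with vertices of valency $1$ and $3$ (loops, multiple edges and finitely many circular components without vertices are allowed), with a cyclic order of the three half-edges at each trivalent vertex and with univalent vertices labelled by elements of $\{1,\dots,n\}$, up to isomorphism. A *Jacobi diagram* is a unitrivalent graph each of whose connected components has at least one univalent vertex. A *tree* is a Jacobi diagram all of whose components are simply connected; a *connected tree* is a (non-empty) connected one. Let $\overline{\mathcal B}(n)$ be the $\mathbb Q$-vector space of finite linear combinations of unitrivalent graphs modulo the AS and IHX relations, an algebra under disjoint union, and let $\mathcal B(n)\subset\overline{\mathcal B}(n)$ be the subalgebra spanned by the Jacobi diagrams. Let $I\subset\overline{\mathcal B}(n)$ be the ideal generated by * the CV relation: if an internal edge joins two distinct trivalent vertices, at which the half-edges are in cyclic order $(x,y,p)$ and $(q,z,t)$, with $p,q$ the two halves of this edge, then the graph equals $2(A-B)$, where $A$ and $B$ are obtained by deleting the edge and its two end vertices and connecting the loose strands $y$ with $z$ and $x$ with $t$ for $A$, and $x$ with $z$ and $y$ with $t$ for $B$ (a circular component arises whenever a strand is closed up); * the relation $\bigcirc_3$: a circular component equals the factor $3$.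 Set $\mathcal B_{sl_2}(n)=\mathcal B(n)/(I\cap\mathcal B(n))$. Let $h,e,f$ be the standard basis of $sl_2$ over $\mathbb Q$, let $\kappa$ be the symmetric bilinear form with $\kappa(h,h)=2$, $\kappa(e,f)=1$ and all other values on basis vectors $0$, let $c=\frac12 h\otimes h+e\otimes f+f\otimes e$, and let $b=\sum_{\sigma\in\mathfrak S_3}(-1)^{|\sigma|}\sigma(h\otimes e\otimes f)$. For a Jacobi diagram $D$ let $W(D)\in S(sl_2)^{\otimes n}$ be obtained by putting a copy of $b$ on each trivalent vertex, contracting by $\kappa$ along each internal edge, putting a copy of $c$ on each component that is a single edge, and multiplying, for each $j$, the factors that belong to univalent vertices labelled $j$ in the $j$-th symmetric algebra. Then: 1. As a $\mathbb Q$-algebra, $\mathcal B_{sl_2}(n)$ is generated by the classes of connected trees. 2. More precisely, in $\mathcal B_{sl_2}(n)$ every Jacobi diagram with $k$ univalent vertices is a linear combination of (not necessarily connected) trees with $k$ univalent vertices. 3. The $sl_2$ weight system is determined by its values on connected trees: $D\mapsto W(D)$ induces a $\mathbb Q$-algebra homomorphism $W\colon\mathcal B_{sl_2}(n)\to S(sl_2)^{\otimes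 n}$, and every $\mathbb Q$-algebra homomorphism $\mathcal B_{sl_2}(n)\to S(sl_2)^{\otimes n}$ that agrees with $W$ on connected trees equals $W$. -/

import Mathlib

/-- The half-edges of a unitrivalent graph with trivalent vertices `V` and univalent vertices `U`:
three half-edges `(v, 0), (v, 1), (v, 2)` at each trivalent vertex `v`, listed in their cyclic
order, and one half-edge at each univalent vertex. -/
abbrev HalfEdge (V U : Type) : Type := (V × Fin 3) ⊕ U

/-- A unitrivalent graph with cyclically ordered trivalent vertices, with univalent vertices
labelled by `n` labels, and with a number of circular components (closed loops without vertices).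
The edges are the orbits of the fixed point free involution `edge` on half-edges; loops at a vertex,
multiple edges and components without univalent vertices are allowed here. -/
structure JacobiDiagram (n : ℕ) where
  /-- trivalent vertices -/
  V : Type
  /-- univalent vertices -/
  U : Type
  [fintypeV : Fintype V]
  [fintypeU : Fintype U]
  /-- the half-edge opposite to a given one on the same edge -/
  edge : HalfEdge V U → HalfEdge V U
  edge_edge : ∀ h, edge (edge h) = h
  edge_ne : ∀ h, edge h ≠ h
  /-- labels of the univalent vertices -/
  label : U → Fin n
  /-- number of circular components -/
  circles : ℕ

attribute [instance] JacobiDiagram.fintypeV JacobiDiagram.fintypeU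

namespace JacobiDiagram

variable {n : ℕ}

/-- The half-edges of `D`. -/
abbrev H (D : JacobiDiagram n) : Type := HalfEdge D.V D.U

/-- The `i`-th half-edge at the trivalent vertex `v`. -/
abbrev half (D : JacobiDiagram n) (v : D.V) (i : Fin 3) : D.H := Sum.inl (v, i)

/-! ### Isomorphisms -/

/-- The map on half-edges induced by maps on vertices, where the half-edges at the trivalent vertex
`v` are rotated by `r v`. -/
def halfMap {V U V' U' : Type} (φ : V → V') (ψ : U → U') (r : V → Fin 3) :
    HalfEdge V U → HalfEdge V' U'
  | Sum.inl p => Sum.inl (φ p.1, p.2 + r p.1)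
  | Sum.inr u => Sum.inr (ψ u)

/-- Isomorphism of diagrams: a graph isomorphism that preserves the labels and the cyclic orders
at trivalent vertices. -/
def IsIso (D E : JacobiDiagram n) : Prop :=
  D.circles = E.circles ∧
  ∃ (φ : D.V ≃ E.V) (ψ : D.U ≃ E.U) (r : D.V → Fin 3),
    (∀ u, E.label (ψ u) = D.label u) ∧
    ∀ h, E.edge (halfMap φ ψ r h) = halfMap φ ψ r (D.edge h)

/-! ### Disjoint union -/

/-- The half-edges of a disjoint union. -/
def sumHalf {V U V' U' : Type} :
    HalfEdge V U ⊕ HalfEdge V' U' ≃ HalfEdge (V ⊕ V') (U ⊕ U') where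
  toFun
    | Sum.inl (Sum.inl (v, i)) => Sum.inl (Sum.inl v, i)
    | Sum.inl (Sum.inr u) => Sum.inr (Sum.inl u)
    | Sum.inr (Sum.inl (v, i)) => Sum.inl (Sum.inr v, i)
    | Sum.inr (Sum.inr u) => Sum.inr (Sum.inr u)
  invFun
    | Sum.inl (Sum.inl v, i) => Sum.inl (Sum.inl (v, i))
    | Sum.inr (Sum.inl u) => Sum.inl (Sum.inr u)
    | Sum.inl (Sum.inr v, i) => Sum.inr (Sum.inl (v, i))
    | Sum.inr (Sum.inr u) => Sum.inr (Sum.inr u)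
  left_inv := by rintro ((⟨v, i⟩ | u) | (⟨v, i⟩ | u)) <;> rfl
  right_inv := by rintro (⟨v | v, i⟩ | (u | u)) <;> rfl

/-- Disjoint union of diagrams. -/
def disjUnion (D E : JacobiDiagram n) : JacobiDiagram n where
  V := D.V ⊕ E.V
  U := D.U ⊕ E.U
  edge h := sumHalf (Sum.map D.edge E.edge (sumHalf.symm h))
  edge_edge h := by
    obtain ⟨k, rfl⟩ := sumHalf.surjective h
    rcases k with k | k <;> simp [D.edge_edge, E.edge_edge]
  edge_ne h := by
    obtain ⟨k, rfl⟩ := sumHalf.surjective h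
    rcases k with k | k <;> simp [D.edge_ne, E.edge_ne]
  label := Sum.elim D.label E.label
  circles := D.circles + E.circles

/-- The empty diagram. -/
def empty (n : ℕ) : JacobiDiagram n where
  V := Empty
  U := Empty
  edge h := h
  edge_edge _ := rfl
  edge_ne h := by rcases h with ⟨v, _⟩ | u <;> exact Empty.elim (by assumption)
  label u := u.elim
  circles := 0

/-- The circle: a single circular component without vertices. -/
def circle (n : ℕ) : JacobiDiagram n := { empty n with circles := 1 }

/-- The unitrivalent graphs up to isomorphism. -/
def Class (n : ℕ) : Type 1 := Quot (IsIso (n := n))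

theorem isIso_refl (D : JacobiDiagram n) : IsIso D D :=
  ⟨rfl, Equiv.refl _, Equiv.refl _, fun _ => 0, fun _ => rfl, fun h => by
    have key : ∀ k : D.H, halfMap (Equiv.refl D.V) (Equiv.refl D.U) (fun _ => 0) k = k := by
      rintro (⟨v, i⟩ | u) <;> simp [halfMap]
    rw [key, key]⟩

theorem edge_sumHalf (D E : JacobiDiagram n) (k : D.H ⊕ E.H) :
    (disjUnion D E).edge (sumHalf k) = sumHalf (Sum.map D.edge E.edge k) := by
  simp [disjUnion]

/-- A criterion for a disjoint union to be isomorphic to another diagram. -/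
theorem isIso_of_sum {D E F : JacobiDiagram n} (hc : D.circles + E.circles = F.circles)
    (φ : D.V ⊕ E.V ≃ F.V) (ψ : D.U ⊕ E.U ≃ F.U) (r : D.V ⊕ E.V → Fin 3)
    (f : D.H → F.H) (g : E.H → F.H)
    (hf : ∀ k, halfMap φ ψ r (sumHalf (Sum.inl k)) = f k)
    (hg : ∀ k, halfMap φ ψ r (sumHalf (Sum.inr k)) = g k)
    (hl : ∀ u, F.label (ψ u) = Sum.elim D.label E.label u)
    (ef : ∀ k, F.edge (f k) = f (D.edge k)) (eg : ∀ k, F.edge (g k) = g (E.edge k)) :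
    IsIso (disjUnion D E) F := by
  refine ⟨hc, φ, ψ, r, hl, fun h => ?_⟩
  obtain ⟨k, rfl⟩ := (sumHalf (V := D.V) (U := D.U) (V' := E.V) (U' := E.U)).surjective h
  rcases k with k | k
  · calc F.edge (halfMap φ ψ r (sumHalf (Sum.inl k))) = f (D.edge k) := by rw [hf, ef]
      _ = halfMap φ ψ r (sumHalf (Sum.inl (D.edge k))) := (hf _).symm
      _ = _ := congrArg (halfMap φ ψ r) (edge_sumHalf D E (Sum.inl k)).symm
  · calc F.edge (halfMap φ ψ r (sumHalf (Sum.inr k))) = g (E.edge k) := by rw [hg, eg]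
      _ = halfMap φ ψ r (sumHalf (Sum.inr (E.edge k))) := (hg _).symm
      _ = _ := congrArg (halfMap φ ψ r) (edge_sumHalf D E (Sum.inr k)).symm

theorem isIso_disjUnion {D D' E E' : JacobiDiagram n} (h₁ : IsIso D D') (h₂ : IsIso E E') :
    IsIso (disjUnion D E) (disjUnion D' E') := by
  obtain ⟨c₁, φ₁, ψ₁, r₁, l₁, e₁⟩ := h₁
  obtain ⟨c₂, φ₂, ψ₂, r₂, l₂, e₂⟩ := h₂
  refine isIso_of_sum (F := disjUnion D' E') (congrArg₂ (· + ·) c₁ c₂)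
    (Equiv.sumCongr φ₁ φ₂) (Equiv.sumCongr ψ₁ ψ₂)
    (Sum.elim r₁ r₂) (fun k => sumHalf (Sum.inl (halfMap φ₁ ψ₁ r₁ k)))
    (fun k => sumHalf (Sum.inr (halfMap φ₂ ψ₂ r₂ k))) ?_ ?_ ?_ ?_ ?_
  · rintro (⟨v, i⟩ | u) <;> rfl
  · rintro (⟨v, i⟩ | u) <;> rfl
  · rintro (u | u)
    · exact l₁ u
    · exact l₂ u
  · intro k
    rw [edge_sumHalf, Sum.map_inl, e₁]
  · intro k
    rw [edge_sumHalf, Sum.map_inr, e₂]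

theorem isIso_comm (D E : JacobiDiagram n) : IsIso (disjUnion D E) (disjUnion E D) := by
  refine isIso_of_sum (F := disjUnion E D) (Nat.add_comm _ _)
    (Equiv.sumComm _ _) (Equiv.sumComm _ _) (fun _ => 0)
    (fun k => sumHalf (Sum.inr k)) (fun k => sumHalf (Sum.inl k)) ?_ ?_ ?_ ?_ ?_
  · rintro (⟨v, i⟩ | u)
    · simp only [halfMap, sumHalf, Equiv.coe_fn_mk, add_zero]
      rfl
    · rfl
  · rintro (⟨v, i⟩ | u)
    · simp only [halfMap, sumHalf, Equiv.coe_fn_mk, add_zero]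
      rfl
    · rfl
  · rintro (u | u) <;> rfl
  · intro k
    rw [edge_sumHalf, Sum.map_inr]
  · intro k
    rw [edge_sumHalf, Sum.map_inl]

theorem isIso_assoc (D E F : JacobiDiagram n) :
    IsIso (disjUnion (disjUnion D E) F) (disjUnion D (disjUnion E F)) := by
  refine isIso_of_sum (F := disjUnion D (disjUnion E F)) (Nat.add_assoc _ _ _)
    (Equiv.sumAssoc _ _ _) (Equiv.sumAssoc _ _ _) (fun _ => 0)
    (fun k => match sumHalf.symm k with
      | Sum.inl a => sumHalf (Sum.inl a)
      | Sum.inr b => sumHalf (Sum.inr (sumHalf (Sum.inl b))))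
    (fun k => sumHalf (Sum.inr (sumHalf (Sum.inr k)))) ?_ ?_ ?_ ?_ ?_
  · rintro (⟨v | v, i⟩ | (u | u)) <;>
      simp only [halfMap, sumHalf, Equiv.coe_fn_mk, Equiv.coe_fn_symm_mk, add_zero] <;> rfl
  · rintro (⟨v, i⟩ | u)
    · simp only [halfMap, sumHalf, Equiv.coe_fn_mk, add_zero]
      rfl
    · rfl
  · rintro ((u | u) | u) <;> rfl
  · intro k
    obtain ⟨k, rfl⟩ := (sumHalf (V := D.V) (U := D.U) (V' := E.V) (U' := E.U)).surjective k
    rcases k with k | k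
    · simp only [edge_sumHalf, Equiv.symm_apply_apply, Sum.map_inl]
      rfl
    · simp only [edge_sumHalf, Equiv.symm_apply_apply, Sum.map_inr]
      exact congrArg (fun z => sumHalf (Sum.inr z)) (edge_sumHalf E F (Sum.inl k))
  · intro k
    rw [edge_sumHalf]
    exact congrArg (fun z => sumHalf (Sum.inr z)) (edge_sumHalf E F (Sum.inr k))

theorem isIso_empty (D : JacobiDiagram n) : IsIso (disjUnion (empty n) D) D := by
  refine isIso_of_sum (Nat.zero_add _)
    (Equiv.emptySum Empty _) (Equiv.emptySum Empty _) (fun _ => 0)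
    (fun k => match k with
      | Sum.inl (v, _) => Empty.elim v
      | Sum.inr u => Empty.elim u)
    (fun k => k) ?_ ?_ ?_ ?_ ?_
  · rintro (⟨v, i⟩ | u)
    · exact Empty.elim v
    · exact Empty.elim u
  · rintro (⟨v, i⟩ | u)
    · simp only [halfMap, sumHalf, Equiv.coe_fn_mk, add_zero]
      rfl
    · rfl
  · rintro (u | u)
    · exact Empty.elim u
    · rfl
  · rintro (⟨v, i⟩ | u)
    · exact Empty.elim v
    · exact Empty.elim u
  · intro k
    rfl

/-- Isomorphism classes of diagrams form a commutative monoid under disjoint union. -/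
instance : CommMonoid (Class n) where
  mul := Quot.map₂ disjUnion (fun D _ _ h => isIso_disjUnion (isIso_refl D) h)
    (fun _ _ E h => isIso_disjUnion h (isIso_refl E))
  one := Quot.mk _ (empty n)
  mul_assoc := by
    rintro ⟨D⟩ ⟨E⟩ ⟨F⟩
    exact Quot.sound (isIso_assoc D E F)
  mul_comm := by
    rintro ⟨D⟩ ⟨E⟩
    exact Quot.sound (isIso_comm D E)
  one_mul := by
    rintro ⟨D⟩
    exact Quot.sound (isIso_empty D)
  mul_one := by
    rintro ⟨D⟩
    exact (Quot.sound (isIso_comm D (empty n))).trans (Quot.sound (isIso_empty D))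

/-! ### Trees and connectivity -/

/-- The underlying graph of `D` without its circular components, with every edge subdivided: the
nodes are the trivalent vertices and the half-edges (the half-edge at a univalent vertex stands
also for that vertex); a trivalent vertex is adjacent to its three half-edges, and a half-edge is
adjacent to the opposite half-edge. This is a simple graph with the same topology as `D`: a loop
at a vertex becomes a triangle and a double edge a hexagon. -/
def skeleton (D : JacobiDiagram n) : SimpleGraph (D.V ⊕ D.H) :=
  SimpleGraph.fromRel fun a b =>
    (∃ v i, a = Sum.inl v ∧ b = Sum.inr (D.half v i)) ∨
    (∃ h, a = Sum.inr h ∧ b = Sum.inr (D.edge h))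

/-- A tree: a simply connected, not necessarily connected, diagram (every component is simply
connected). -/
def IsTree (D : JacobiDiagram n) : Prop := D.circles = 0 ∧ D.skeleton.IsAcyclic

/-- A connected tree: a connected and simply connected (in particular non-empty) diagram. -/
def IsConnectedTree (D : JacobiDiagram n) : Prop := D.circles = 0 ∧ D.skeleton.IsTree

/-- Every connected component has at least one univalent vertex. -/
def IsOpen (D : JacobiDiagram n) : Prop :=
  D.circles = 0 ∧
  ∀ v : D.V, ∃ u : D.U, D.skeleton.Reachable (Sum.inl v) (Sum.inr (Sum.inr u))

/-! ### Local modifications -/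

/-- Permute the ends of the edges: an edge ending in `h` now ends in `π h`. -/
def reattach (D : JacobiDiagram n) (π : Equiv.Perm D.H) : JacobiDiagram n where
  V := D.V
  U := D.U
  edge h := π (D.edge (π.symm h))
  edge_edge h := by simp [D.edge_edge]
  edge_ne h := by
    intro e
    have := congrArg π.symm e
    rw [Equiv.symm_apply_apply] at this
    exact D.edge_ne _ this
  label := D.label
  circles := D.circles

open Classical in
/-- Reverse the cyclic order at the trivalent vertex `v`. -/
noncomputable def flip (D : JacobiDiagram n) (v : D.V) : JacobiDiagram n :=
  D.reattach (Equiv.swap (D.half v 0) (D.half v 1))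

open Classical in
/-- For an internal edge joining `(u, 2)` to `(w, 0)`, the cyclic permutation
`(u, 0) ↦ (u, 1) ↦ (w, 1) ↦ (u, 0)` of three of the four ends around this edge. -/
noncomputable def rotation (D : JacobiDiagram n) (u w : D.V) : Equiv.Perm D.H :=
  Equiv.swap (D.half u 0) (D.half u 1) * Equiv.swap (D.half u 1) (D.half w 1)

open Classical in
/-- Join the two half-edges `a ≠ b`: afterwards `a` and `b` are opposite to each other, and so are
the half-edges that were opposite to `a` and `b`. If `a` and `b` were already opposite, nothing
changes. -/
noncomputable def join (D : JacobiDiagram n) (a b : D.H) : JacobiDiagram n :=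
  D.reattach (Equiv.swap b (D.edge a))

open Classical in
theorem join_left (D : JacobiDiagram n) {a b : D.H} (hab : a ≠ b) : (D.join a b).edge a = b := by
  simp only [join, reattach, Equiv.symm_swap]
  rw [Equiv.swap_apply_of_ne_of_ne hab (D.edge_ne a).symm, Equiv.swap_apply_right]

open Classical in
theorem join_right (D : JacobiDiagram n) {a b : D.H} (hab : a ≠ b) : (D.join a b).edge b = a := by
  have h := (D.join a b).edge_edge a
  rwa [join_left D hab] at h

open Classical in
theorem join_other (D : JacobiDiagram n) {a b h : D.H} (h1 : h ≠ a) (h2 : h ≠ b)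
    (h3 : D.edge h ≠ a) (h4 : D.edge h ≠ b) : (D.join a b).edge h = D.edge h := by
  have h5 : h ≠ D.edge a := fun e => h3 (by rw [e, D.edge_edge])
  have h6 : D.edge h ≠ D.edge a := fun e => h1 (by rw [← D.edge_edge h, e, D.edge_edge])
  simp only [join, reattach, Equiv.symm_swap]
  rw [Equiv.swap_apply_of_ne_of_ne h2 h5, Equiv.swap_apply_of_ne_of_ne h4 h6]

/-- The half-edge `h` is at one of the trivalent vertices `u`, `w`. -/
def At (D : JacobiDiagram n) (u w : D.V) (h : D.H) : Prop :=
  ∃ i, h = D.half u i ∨ h = D.half w i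

/-- Half-edges of the graph from which the trivalent vertices `u` and `w` are deleted. -/
def keep (D : JacobiDiagram n) (u w : D.V) :
    HalfEdge {v : D.V // v ≠ u ∧ v ≠ w} D.U ≃ {h : D.H // ¬ D.At u w h} where
  toFun
    | Sum.inl (v, i) => ⟨Sum.inl (v.1, i), by
        rintro ⟨j, e | e⟩
        · exact v.2.1 (congrArg Prod.fst (Sum.inl.inj e))
        · exact v.2.2 (congrArg Prod.fst (Sum.inl.inj e))⟩
    | Sum.inr x => ⟨Sum.inr x, by rintro ⟨j, e | e⟩ <;> cases e⟩
  invFun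
    | ⟨Sum.inl (v, i), hv⟩ => Sum.inl (⟨v, fun e => hv ⟨i, Or.inl (by rw [e])⟩,
        fun e => hv ⟨i, Or.inr (by rw [e])⟩⟩, i)
    | ⟨Sum.inr x, _⟩ => Sum.inr x
  left_inv := by rintro (⟨v, i⟩ | x) <;> rfl
  right_inv := by rintro ⟨⟨v, i⟩ | x, h⟩ <;> rfl

open Classical in
/-- Delete the trivalent vertices `u`, `w` together with all edges at them, when these edges have
both of their ends at `u` or `w`; then add `c` circular components. -/
noncomputable def delete (D : JacobiDiagram n) (u w : D.V)
    (hD : ∀ h, D.At u w h → D.At u w (D.edge h)) (c : ℕ) : JacobiDiagram n where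
  V := {v : D.V // v ≠ u ∧ v ≠ w}
  U := D.U
  edge h := (D.keep u w).symm ⟨D.edge (D.keep u w h).1, fun e =>
    (D.keep u w h).2 (by simpa [D.edge_edge] using hD _ e)⟩
  edge_edge h := by simp [D.edge_edge]
  edge_ne h := by
    intro e
    have := congrArg (fun k => (D.keep u w k).1) e
    simp only [Equiv.apply_symm_apply] at this
    exact D.edge_ne _ this
  label := D.label
  circles := D.circles + c

theorem smooth_aux (D : JacobiDiagram n) {u w : D.V} (huw : u ≠ w)
    (he : D.edge (D.half u 2) = D.half w 0) (x y : Fin 3) (hxy : x ≠ y) (hx : x ≠ 2) (hy : y ≠ 2) :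
    ∀ h, ((D.join (D.half u y) (D.half w 1)).join (D.half u x) (D.half w 2)).At u w h →
      ((D.join (D.half u y) (D.half w 1)).join (D.half u x) (D.half w 2)).At u w
        (((D.join (D.half u y) (D.half w 1)).join (D.half u x) (D.half w 2)).edge h) := by
  have he' : D.edge (D.half w 0) = D.half u 2 := by rw [← he, D.edge_edge]
  have n1 : ∀ i j, D.half u i ≠ D.half w j := fun i j e =>
    huw (congrArg Prod.fst (Sum.inl.inj e))
  have n2 : ∀ (v : D.V) (i j : Fin 3), i ≠ j → D.half v i ≠ D.half v j := fun v i j h e =>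
    h (congrArg Prod.snd (Sum.inl.inj e))
  set D₁ := D.join (D.half u y) (D.half w 1) with hD₁
  have a1 : D₁.edge (D.half u y) = D.half w 1 := D.join_left (n1 _ _)
  have a2 : D₁.edge (D.half w 1) = D.half u y := D.join_right (n1 _ _)
  have a3 : D₁.edge (D.half u 2) = D.half w 0 := by
    rw [← he]
    refine D.join_other (n2 _ _ _ hy.symm) (n1 _ _) ?_ ?_ <;> rw [he]
    · exact (n1 _ _).symm
    · exact n2 _ _ _ (by decide)
  have a4 : D₁.edge (D.half w 0) = D.half u 2 := by rw [← a3]; exact D₁.edge_edge _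
  set D₂ := D₁.join (D.half u x) (D.half w 2) with hD₂
  have b1 : D₂.edge (D.half u x) = D.half w 2 := D₁.join_left (n1 _ _)
  have b2 : D₂.edge (D.half w 2) = D.half u x := D₁.join_right (n1 _ _)
  have b3 : D₂.edge (D.half u 2) = D.half w 0 := by
    rw [← a3]
    refine D₁.join_other (n2 _ _ _ hx.symm) (n1 _ _) ?_ ?_ <;> rw [a3]
    · exact (n1 _ _).symm
    · exact n2 _ _ _ (by decide)
  have b4 : D₂.edge (D.half w 0) = D.half u 2 := by rw [← b3]; exact D₂.edge_edge _
  have b5 : D₂.edge (D.half u y) = D.half w 1 := by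
    rw [← a1]
    refine D₁.join_other (n2 _ _ _ hxy.symm) (n1 _ _) ?_ ?_ <;> rw [a1]
    · exact (n1 _ _).symm
    · exact n2 _ _ _ (by decide)
  have b6 : D₂.edge (D.half w 1) = D.half u y := by rw [← b5]; exact D₂.edge_edge _
  rintro h ⟨i, rfl | rfl⟩
  · have : i = x ∨ i = y ∨ i = 2 := by omega
    rcases this with rfl | rfl | rfl
    · exact ⟨2, Or.inr b1⟩
    · exact ⟨1, Or.inr b5⟩
    · exact ⟨0, Or.inr b3⟩
  · have : i = 0 ∨ i = 1 ∨ i = 2 := by omega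
    rcases this with rfl | rfl | rfl
    · exact ⟨2, Or.inl b4⟩
    · exact ⟨y, Or.inl b6⟩
    · exact ⟨x, Or.inl b2⟩

open Classical in
/-- Smoothing of the internal edge joining `(u, 2)` to `(w, 0)`, where `u ≠ w` and `{x, y} = {0, 1}`:
the edge and its two end vertices are removed, the strand that ended in `(u, y)` is connected to the
one that ended in `(w, 1)`, and the strand that ended in `(u, x)` to the one that ended in `(w, 2)`.
A circular component arises whenever two strands to be connected are the two ends of one edge. -/
noncomputable def smooth (D : JacobiDiagram n) (u w : D.V) (huw : u ≠ w)
    (he : D.edge (D.half u 2) = D.half w 0) (x y : Fin 3) (hxy : x ≠ y) (hx : x ≠ 2) (hy : y ≠ 2) :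
    JacobiDiagram n :=
  ((D.join (D.half u y) (D.half w 1)).join (D.half u x) (D.half w 2)).delete u w
    (D.smooth_aux huw he x y hxy hx hy)
    ((if D.edge (D.half u y) = D.half w 1 then 1 else 0) +
      (if (D.join (D.half u y) (D.half w 1)).edge (D.half u x) = D.half w 2 then 1 else 0))

/-! ### The algebras of diagrams -/

/-- The diagram `D` as an element of the `ℚ`-algebra spanned by isomorphism classes of diagrams, with
disjoint union as product. -/
noncomputable def toAlg (D : JacobiDiagram n) : MonoidAlgebra ℚ (Class n) :=
  MonoidAlgebra.of ℚ (Class n) (Quot.mk _ D)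

end JacobiDiagram

/-- The ideal of the AS relations (reversing the cyclic order at a trivalent vertex changes the sign)
and the IHX relations. -/
noncomputable def idealASIHX (n : ℕ) : Ideal (MonoidAlgebra ℚ (JacobiDiagram.Class n)) :=
  Ideal.span
    ({r | ∃ (D : JacobiDiagram n) (v : D.V), r = (D.flip v).toAlg + D.toAlg} ∪
     {r | ∃ (D : JacobiDiagram n) (u w : D.V), u ≠ w ∧ D.edge (D.half u 2) = D.half w 0 ∧
        r = D.toAlg + (D.reattach (D.rotation u w)).toAlg +
          (D.reattach (D.rotation u w * D.rotation u w)).toAlg})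

/-- Diagrams modulo AS and IHX, where components without univalent vertices and circular components
are allowed. -/
abbrev BAll (n : ℕ) : Type 1 := MonoidAlgebra ℚ (JacobiDiagram.Class n) ⧸ idealASIHX n

/-- The class of a diagram in `BAll n`. -/
noncomputable def JacobiDiagram.toBAll {n : ℕ} (D : JacobiDiagram n) : BAll n :=
  Ideal.Quotient.mk (idealASIHX n) D.toAlg

/-- The algebra of Jacobi diagrams modulo AS and IHX, every component of a Jacobi diagram having at
least one univalent vertex. (Such diagrams are closed under disjoint union, so that the subalgebra
that they generate is their linear span.) -/
noncomputable def BJac (n : ℕ) : Subalgebra ℚ (BAll n) :=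
  Algebra.adjoin ℚ {b | ∃ D : JacobiDiagram n, D.IsOpen ∧ b = D.toBAll}

/-- The ideal of the CV relations and of the relation that replaces a circular component by the factor
`3`. With `(u, 2)` joined to `(w, 0)`, the plane picture has the edge from `u` to `w` drawn
horizontally, with the ends `(u, 0), (u, 1)` in the upper left and lower left, and `(w, 2), (w, 1)`
in the upper right and lower right. The CV relation replaces this by twice the difference of the two
parallel horizontal strands and of the two crossing strands. -/
noncomputable def idealCV (n : ℕ) : Ideal (BAll n) :=
  Ideal.span
    ({r | ∃ (D : JacobiDiagram n) (u w : D.V) (huw : u ≠ w)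
        (he : D.edge (D.half u 2) = D.half w 0),
        r = D.toBAll -
          2 * ((D.smooth u w huw he 0 1 (by decide) (by decide) (by decide)).toBAll -
            (D.smooth u w huw he 1 0 (by decide) (by decide) (by decide)).toBAll)} ∪
     {(JacobiDiagram.circle n).toBAll - 3})

/-- The algebra of `sl₂`-Jacobi diagrams: the quotient of the algebra `BJac n` of Jacobi diagrams by
the CV relation and the circle relation. (The intermediate terms of these relations may have components
without univalent vertices.) -/
abbrev Bsl2 (n : ℕ) : Type 1 := BJac n ⧸ (idealCV n).comap (BJac n).val

/-- The class in `Bsl2 n` of a Jacobi diagram. -/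
noncomputable def JacobiDiagram.toBsl2 {n : ℕ} (D : JacobiDiagram n) (hD : D.IsOpen) : Bsl2 n :=
  Ideal.Quotient.mk ((idealCV n).comap (BJac n).val)
    ⟨D.toBAll, Algebra.subset_adjoin ⟨D, hD, rfl⟩⟩

/-! ### The weight system -/

/-- The Lie algebra `sl₂` over `ℚ`. -/
abbrev sl2 : Type := LieAlgebra.SpecialLinear.sl (Fin 2) ℚ

/-- The basis `h, e, f` of `sl₂`. -/
def sl2Basis : Fin 3 → sl2 :=
  ![⟨!![1, 0; 0, -1], by simp [LieAlgebra.SpecialLinear.sl, Matrix.trace_fin_two]⟩,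
    ⟨!![0, 1; 0, 0], by simp [LieAlgebra.SpecialLinear.sl, Matrix.trace_fin_two]⟩,
    ⟨!![0, 0; 1, 0], by simp [LieAlgebra.SpecialLinear.sl, Matrix.trace_fin_two]⟩]

/-- The bilinear form `κ` in the basis `h, e, f`. -/
def kappa : Matrix (Fin 3) (Fin 3) ℚ := !![2, 0, 0; 0, 0, 1; 0, 1, 0]

theorem kappa_comm (i j : Fin 3) : kappa i j = kappa j i := by
  fin_cases i <;> fin_cases j <;> rfl

/-- The `κ`-dual basis `h / 2, f, e` of `sl₂`. -/
def sl2DualBasis : Fin 3 → sl2 := ![(1 / 2 : ℚ) • sl2Basis 0, sl2Basis 2, sl2Basis 1]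

/-- The coefficients of the invariant tensor `b = ∑ σ, sign σ • σ (h ⊗ e ⊗ f)` in the basis
`h, e, f`. -/
def bCoeff (i j k : Fin 3) : ℚ :=
  ∑ σ : Equiv.Perm (Fin 3), if σ 0 = i ∧ σ 1 = j ∧ σ 2 = k then ((Equiv.Perm.sign σ : ℤ) : ℚ) else 0

/-- The algebra `S(sl₂)^{⊗ n}`. -/
abbrev STensor (n : ℕ) : Type :=
  PiTensorProduct ℚ (fun _ : Fin n => SymmetricAlgebra ℚ sl2)

/-- The element `1 ⊗ ⋯ ⊗ x ⊗ ⋯ ⊗ 1` with `x ∈ sl₂` at the `j`-th position. -/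
noncomputable def place {n : ℕ} (j : Fin n) (x : sl2) : STensor n :=
  PiTensorProduct.tprod ℚ (Function.update 1 j (SymmetricAlgebra.ι ℚ sl2 x))

open Classical in
/-- The value of the `sl₂` weight system on a diagram, as a state sum in the basis `h, e, f`: put the
tensor `b` on each trivalent vertex, put `∑ i, x_i ⊗ x_i^*` on each univalent vertex labelled `j`, with
`x_i^*` in the `j`-th symmetric algebra, contract by `κ` along each edge, and count a factor `3` for
each circular component. As `∑ i, κ(x, x_i) x_i^* = x`, an edge from a trivalent to a univalent vertex
labelled `j` puts the tensor factor at the trivalent vertex in the `j`-th symmetric algebra; as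
`∑ i k, κ(x_i, x_k) x_i^* ⊗ x_k^*` is the Casimir tensor, a strut has this tensor as its value. -/
noncomputable def JacobiDiagram.weight {n : ℕ} (D : JacobiDiagram n) : STensor n :=
  3 ^ D.circles *
    ∑ c : D.H → Fin 3,
      (((∏ v : D.V, bCoeff (c (D.half v 0)) (c (D.half v 1)) (c (D.half v 2))) *
        ∏ e ∈ Finset.univ.image (fun h : D.H => s(h, D.edge h)),
          Sym2.lift ⟨fun h k => kappa (c h) (c k), fun _ _ => kappa_comm _ _⟩ e) •
        ∏ u : D.U, place (D.label u) (sl2DualBasis (c (Sum.inr u))))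

/-!
The CV relation may be applied to *every* edge between two distinct trivalent vertices, also to an edge
of a tree. Each application removes two trivalent vertices and keeps the univalent ones, a loop at a
trivalent vertex makes a diagram vanish by AS, and a circular component is the factor `3`. By induction
on the number of trivalent vertices, every diagram (open or not) is therefore, modulo CV and the circle
relation, a linear combination of diagrams without circular components and without edges between
trivalent vertices, with the same number of univalent vertices: `toCV_mem_span`. These "scattered"
diagrams are disjoint unions of tripods and struts. So they are forests (`IsScattered.isTree`) and
products of connected trees (`IsScattered.toBsl2_mem_adjoin`). As `Bsl2 n` embeds into the quotient of
`BAll n` by the full ideal, the first two claims follow, and so does the uniqueness of the weight system.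

The weight system is the case `P j i = place j (sl2DualBasis i)` of a state sum with values in an
arbitrary commutative algebra (`stateSum`): the contraction `contract` by `κ` along the edges of a tensor
that is a product over the vertices. It is defined for all diagrams, so that its compatibility with the
relations can be checked there. AS is the antisymmetry of `b`, IHX the Jacobi identity, and CV
(`stateSum_cv`) is the identity `sum_bCoeff_kappa_bCoeff`, which writes the tensor on an internal edge as
`2` times a difference of products of Casimir tensors, together with the fact that contracting two
half-edges with a Casimir tensor joins their edges, or closes up a circle of value `3`
(`contract_join_or_circle`, `contract_delete`).
-/

/-! ### Contraction of tensors along the edges -/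

section Contraction

variable {H H' : Type} {M : Type*} [AddCommGroup M] [Module ℚ M]

/-- The value `κ (c h) (c k)` of a colouring `c` of half-edges on the edge `{h, k}`. -/
def edgeVal (c : H → Fin 3) : Sym2 H → ℚ :=
  Sym2.lift ⟨fun h k => kappa (c h) (c k), fun _ _ => kappa_comm _ _⟩

open Classical in
/-- The product of `κ` over the edges `{h, τ h}` with `h ∈ s`. -/
noncomputable def edgeProdOn (s : Finset H) (τ : H → H) (c : H → Fin 3) : ℚ :=
  ∏ e ∈ s.image (fun h => s(h, τ h)), edgeVal c e

open Classical in
theorem edgeProdOn_congr {s : Finset H} {τ τ' : H → H} {c c' : H → Fin 3}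
    (hτ : ∀ h ∈ s, τ h = τ' h) (hc : ∀ h ∈ s, c h = c' h) (hc' : ∀ h ∈ s, c (τ h) = c' (τ h)) :
    edgeProdOn s τ c = edgeProdOn s τ' c' := by
  unfold edgeProdOn
  have : s.image (fun h => s(h, τ h)) = s.image (fun h => s(h, τ' h)) :=
    Finset.image_congr fun h hh => by simp only [hτ h hh]
  rw [← this]
  refine Finset.prod_congr rfl fun e he => ?_
  obtain ⟨h, hh, rfl⟩ := Finset.mem_image.1 he
  simp only [edgeVal, Sym2.lift_mk, hc h hh, hc' h hh]

open Classical in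
theorem edgeProdOn_eq_prod {s : Finset H} {τ : H → H} {t : Finset (Sym2 H)}
    (ht : ∀ e, e ∈ t ↔ ∃ h ∈ s, s(h, τ h) = e) (c : H → Fin 3) :
    edgeProdOn s τ c = ∏ e ∈ t, edgeVal c e :=
  Finset.prod_congr (by ext e; rw [ht, Finset.mem_image]) fun _ _ => rfl

open Classical in
theorem edgeProdOn_erase {s : Finset H} {τ : H → H} (hτ : ∀ h, τ (τ h) = h) {a : H} (ha : a ∈ s)
    (c : H → Fin 3) :
    edgeProdOn s τ c =
      kappa (c a) (c (τ a)) * edgeProdOn ((s.erase a).erase (τ a)) τ c := by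
  unfold edgeProdOn
  have hi : s.image (fun h => s(h, τ h)) =
      insert s(a, τ a) (((s.erase a).erase (τ a)).image (fun h => s(h, τ h))) := by
    ext e
    simp only [Finset.mem_image, Finset.mem_insert, Finset.mem_erase]
    constructor
    · rintro ⟨h, hh, rfl⟩
      by_cases h1 : h = a
      · left; rw [h1]
      by_cases h2 : h = τ a
      · left; rw [h2, hτ, Sym2.eq_swap]
      · exact Or.inr ⟨h, ⟨h2, h1, hh⟩, rfl⟩
    · rintro (rfl | ⟨h, ⟨_, _, hh⟩, rfl⟩)
      · exact ⟨a, ha, rfl⟩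
      · exact ⟨h, hh, rfl⟩
  rw [hi, Finset.prod_insert]
  · rfl
  · simp only [Finset.mem_image, Finset.mem_erase, not_exists, not_and]
    rintro h ⟨h2, h1, _⟩ e
    rcases Sym2.eq_iff.1 e with ⟨e1, _⟩ | ⟨e1, _⟩
    · exact h1 e1
    · exact h2 e1

variable [Fintype H] [Fintype H']

/-- The product of `κ` over all edges `{h, τ h}`. -/
noncomputable def edgeProd (τ : H → H) (c : H → Fin 3) : ℚ := edgeProdOn Finset.univ τ c

open Classical in
/-- The contraction by `κ` along the edges `{h, τ h}` of a tensor with one index for each half-edge,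
given by its coefficients in the basis `h, e, f`. -/
noncomputable def contract (τ : H → H) (T : (H → Fin 3) → M) : M :=
  ∑ c : H → Fin 3, edgeProd τ c • T c

open Classical in
theorem edgeProd_equiv {τ : H → H} {τ' : H' → H'} (σ : H ≃ H') (hσ : ∀ h, τ' (σ h) = σ (τ h))
    (c : H' → Fin 3) : edgeProd τ' c = edgeProd τ (c ∘ σ) := by
  unfold edgeProd edgeProdOn
  have hi : Finset.univ.image (fun h => s(h, τ' h)) =
      (Finset.univ.image (fun h => s(h, τ h))).image (Sym2.map σ) := by
    ext e
    simp only [Finset.mem_image, Finset.mem_univ, true_and, exists_exists_eq_and, Sym2.map_mk]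
    constructor
    · rintro ⟨h, rfl⟩
      exact ⟨σ.symm h, by rw [← hσ, σ.apply_symm_apply]⟩
    · rintro ⟨h, rfl⟩
      exact ⟨σ h, by rw [hσ]⟩
  rw [hi, Finset.prod_image (fun x _ y _ h => Sym2.map.injective σ.injective h)]
  refine Finset.prod_congr rfl fun e _ => ?_
  induction e with | _ x y => rfl

open Classical in
theorem contract_equiv {τ : H → H} {τ' : H' → H'} (σ : H ≃ H') (hσ : ∀ h, τ' (σ h) = σ (τ h))
    {T : (H → Fin 3) → M} {T' : (H' → Fin 3) → M} (hT : ∀ c, T' c = T (c ∘ σ)) :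
    contract τ' T' = contract τ T := by
  unfold contract
  refine Fintype.sum_equiv (σ.symm.arrowCongr (Equiv.refl _)) _ _ fun c => ?_
  rw [edgeProd_equiv σ hσ, hT]
  rfl

open Classical in
theorem contract_of_isEmpty (hH : H → False) (τ : H → H) (T : (H → Fin 3) → M)
    (c₀ : H → Fin 3) : contract τ T = T c₀ := by
  unfold contract
  refine (Finset.sum_eq_single c₀ (fun c _ hc => (hc (funext fun h => (hH h).elim)).elim)
    (fun h => (h (Finset.mem_univ _)).elim)).trans ?_
  rw [edgeProd, edgeProdOn_eq_prod (t := ∅) (fun e => by simpa using fun h => (hH h).elim),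
    Finset.prod_empty, one_smul]

theorem contract_add (τ : H → H) (T T' : (H → Fin 3) → M) :
    contract τ (fun c => T c + T' c) = contract τ T + contract τ T' := by
  simp only [contract, smul_add, Finset.sum_add_distrib]

theorem contract_smul (τ : H → H) (x : ℚ) (T : (H → Fin 3) → M) :
    contract τ (fun c => x • T c) = x • contract τ T := by
  simp only [contract, Finset.smul_sum, smul_comm x]

theorem contract_smul_const (τ : H → H) (T : (H → Fin 3) → ℚ) (x : M) :
    contract τ (fun c => T c • x) = contract τ T • x := by
  simp only [contract, Finset.sum_smul, smul_assoc]

theorem contract_mul_contract {A : Type*} [CommRing A] [Algebra ℚ A] (τ : H → H) (τ' : H' → H')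
    (T : (H → Fin 3) → A) (T' : (H' → Fin 3) → A) :
    contract τ (fun c => contract τ' (fun c' => T c * T' c')) = contract τ T * contract τ' T' := by
  simp only [contract, Finset.sum_mul, Finset.mul_sum, Finset.smul_sum, smul_mul_assoc,
    mul_smul_comm]
  rw [Finset.sum_comm]
  exact Finset.sum_congr rfl fun _ _ => Finset.sum_congr rfl fun _ _ => smul_comm _ _ _

open Classical in
theorem edgeProd_sum (τ : H → H) (τ' : H' → H') (c : H ⊕ H' → Fin 3) :
    edgeProd (Sum.map τ τ') c = edgeProd τ (c ∘ Sum.inl) * edgeProd τ' (c ∘ Sum.inr) := by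
  rw [edgeProd, edgeProdOn_eq_prod
      (t := (Finset.univ.image (fun h => s(h, τ h))).image (Sym2.map Sum.inl) ∪
        (Finset.univ.image (fun h => s(h, τ' h))).image (Sym2.map Sum.inr)),
    Finset.prod_union, Finset.prod_image (fun x _ y _ h => Sym2.map.injective Sum.inl_injective h),
    Finset.prod_image (fun x _ y _ h => Sym2.map.injective Sum.inr_injective h)]
  · congr 1 <;> refine Finset.prod_congr rfl fun e _ => ?_ <;> induction e with | _ x y => rfl
  · rw [Finset.disjoint_left]
    simp only [Finset.mem_image, Finset.mem_univ, true_and, exists_exists_eq_and, Sym2.map_mk]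
    rintro _ ⟨x, rfl⟩ ⟨y, h⟩
    simp at h
  · intro e
    simp only [Finset.mem_image, Finset.mem_univ, true_and, exists_exists_eq_and, Sym2.map_mk,
      Finset.mem_union, Sum.exists, Sum.map_inl, Sum.map_inr]

open Classical in
theorem contract_sum (τ : H → H) (τ' : H' → H') (T : (H ⊕ H' → Fin 3) → M) :
    contract (Sum.map τ τ') T = contract τ (fun c => contract τ' (fun c' => T (Sum.elim c c'))) := by
  unfold contract
  simp only [Finset.smul_sum, smul_smul]
  refine Eq.trans ?_ (Fintype.sum_prod_type
    (fun x : (H → Fin 3) × (H' → Fin 3) =>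
      (edgeProd τ x.1 * edgeProd τ' x.2) • T (Sum.elim x.1 x.2)))
  refine Finset.sum_equiv (Equiv.sumArrowEquivProdArrow H H' (Fin 3)) (by simp) fun c _ => ?_
  rw [edgeProd_sum]
  congr 2
  exact (Sum.elim_comp_inl_inr c).symm

open Classical in
/-- Every colouring arises three times by changing the colour of `a` in another one. -/
theorem three_smul_sum (a : H) (F : (H → Fin 3) → M) :
    (3 : ℚ) • ∑ c, F c = ∑ c, ∑ p, F (Function.update c a p) := by
  -- `(c, p) ↦ (update c a p, c a)` is an involution
  have key : ∑ x : (H → Fin 3) × Fin 3, F x.1 =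
      ∑ x : (H → Fin 3) × Fin 3, F (Function.update x.1 a x.2) := by
    refine Finset.sum_bij' (fun x _ => (Function.update x.1 a x.2, x.1 a))
      (fun x _ => (Function.update x.1 a x.2, x.1 a)) ?_ ?_ ?_ ?_ ?_ <;> simp
  rw [Fintype.sum_prod_type, Fintype.sum_prod_type] at key
  rw [← key, Finset.smul_sum]
  refine Finset.sum_congr rfl fun c _ => ?_
  simp only [Finset.sum_const, Finset.card_univ, Fintype.card_fin, ← Nat.cast_smul_eq_nsmul ℚ]
  norm_num

open Classical in
/-- Averaging over the indices at two half-edges. -/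
theorem sum_eq_sum_of_update (a b : H) {F G : (H → Fin 3) → M}
    (h : ∀ c, ∑ p, ∑ q, F (Function.update (Function.update c a p) b q) =
      ∑ p, ∑ q, G (Function.update (Function.update c a p) b q)) :
    ∑ c, F c = ∑ c, G c := by
  -- averaging over both indices multiplies a sum over all colourings by `9`
  have h9 : ∀ F : (H → Fin 3) → M, (3 : ℚ) • (3 : ℚ) • ∑ c, F c =
      ∑ c, ∑ p, ∑ q, F (Function.update (Function.update c a p) b q) := fun F => by
    rw [three_smul_sum b, three_smul_sum a]
  have h3 : (3 : ℚ) ≠ 0 := by norm_num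
  have := (h9 F).trans ((Finset.sum_congr rfl fun c _ => h c).trans (h9 G).symm)
  exact smul_right_injective M h3 (smul_right_injective M h3 this)

open Classical in
/-- Tensors that agree after contraction along the edge `{a, τ a}` have equal contractions. -/
theorem contract_congr {τ : H → H} (hτ : ∀ h, τ (τ h) = h) (hne : ∀ h, τ h ≠ h) (a : H)
    {T T' : (H → Fin 3) → M}
    (h : ∀ c, ∑ p, ∑ q, kappa p q • T (Function.update (Function.update c a p) (τ a) q) =
      ∑ p, ∑ q, kappa p q • T' (Function.update (Function.update c a p) (τ a) q)) :
    contract τ T = contract τ T' := by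
  refine sum_eq_sum_of_update a (τ a) fun c => ?_
  have key : ∀ p q, edgeProd τ (Function.update (Function.update c a p) (τ a) q) =
      edgeProdOn ((Finset.univ.erase a).erase (τ a)) τ c * kappa p q := fun p q => by
    rw [edgeProd, edgeProdOn_erase hτ (Finset.mem_univ a), Function.update_self,
      Function.update_of_ne (hne a).symm, Function.update_self, mul_comm]
    congr 1
    refine edgeProdOn_congr (fun _ _ => rfl) (fun h hh => ?_) (fun h hh => ?_) <;>
      simp only [Finset.mem_erase, Finset.mem_univ, and_true] at hh
    · rw [Function.update_of_ne hh.1, Function.update_of_ne hh.2]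
    · rw [Function.update_of_ne, Function.update_of_ne]
      · intro e; exact hh.1 (by rw [← e, hτ])
      · intro e; exact hh.2 (by rw [← hτ h, e, hτ])
  simp only [key, mul_smul, ← Finset.smul_sum, h c]

/-- The coefficients of the Casimir tensor, the inverse matrix of `kappa`. -/
def casimir : Fin 3 → Fin 3 → ℚ := ![![1 / 2, 0, 0], ![0, 0, 1], ![0, 1, 0]]

theorem casimir_comm (i j : Fin 3) : casimir i j = casimir j i := by
  fin_cases i <;> fin_cases j <;> rfl

theorem sum_casimir_kappa : ∑ p, ∑ q, casimir p q * kappa p q = 3 := by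
  simp [Fin.sum_univ_three, casimir, kappa]; norm_num

theorem sum_casimir_kappa_kappa (x y : Fin 3) :
    ∑ p, ∑ q, casimir p q * (kappa p x * kappa q y) = kappa x y := by
  fin_cases x <;> fin_cases y <;> simp [Fin.sum_univ_three, casimir, kappa]

open Classical in
theorem edgeProd_swap (c : H ⊕ H → Fin 3) :
    edgeProd Sum.swap c = ∏ i, kappa (c (Sum.inl i)) (c (Sum.inr i)) := by
  rw [edgeProd, edgeProdOn_eq_prod (t := Finset.univ.image fun i => s(Sum.inl i, Sum.inr i)),
    Finset.prod_image (fun x _ y _ h => by simpa [Sym2.eq_iff] using h)]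
  · rfl
  · intro e
    simp [Sym2.eq_swap (a := Sum.inr _)]

open Classical in
/-- A closed strand with a Casimir tensor on it has the value `3`, the dimension of `sl₂`. -/
theorem contract_swap_casimir : contract Sum.swap
      (fun c : H ⊕ H → Fin 3 => ∏ i, casimir (c (Sum.inl i)) (c (Sum.inr i))) =
    3 ^ Fintype.card H := by
  have h3 : ∏ _i : H, ∑ x : Fin 3 × Fin 3, casimir x.1 x.2 * kappa x.1 x.2 =
      3 ^ Fintype.card H := by
    rw [Finset.prod_const, Fintype.sum_prod_type, sum_casimir_kappa, Finset.card_univ]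
  rw [← h3, Finset.prod_univ_sum, Fintype.piFinset_univ]
  unfold contract
  refine Finset.sum_equiv ((Equiv.sumArrowEquivProdArrow H H (Fin 3)).trans
    (Equiv.arrowProdEquivProdArrow H (fun _ => Fin 3) (fun _ => Fin 3)).symm) (by simp) fun c _ => ?_
  rw [edgeProd_swap, smul_eq_mul, ← Finset.prod_mul_distrib]
  exact Finset.prod_congr rfl fun i _ => mul_comm _ _

open Classical in
/-- Contracting two half-edges `a`, `b` on different edges with the Casimir tensor joins the other
two ends of these edges. The left out edge `{a, b}` of the joined graph accounts for the factor. -/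
theorem contract_join {τ τ' : H → H} (hτ : ∀ h, τ (τ h) = h) (hne : ∀ h, τ h ≠ h)
    (hτ' : ∀ h, τ' (τ' h) = h) {a b : H} (hab : a ≠ b) (hn : τ a ≠ b)
    (h1 : τ' a = b) (h2 : τ' (τ a) = τ b)
    (h3 : ∀ h, h ≠ a → h ≠ b → h ≠ τ a → h ≠ τ b → τ' h = τ h) {T : (H → Fin 3) → M}
    (hT : ∀ c c', (∀ h, h ≠ a → h ≠ b → c h = c' h) → T c = T c') :
    contract τ' (fun c => casimir (c a) (c b) • T c) =
      (3 : ℚ) • contract τ (fun c => casimir (c a) (c b) • T c) := by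
  unfold contract
  rw [Finset.smul_sum]
  refine sum_eq_sum_of_update a b fun c => ?_
  -- only the edges at `a`, `b` differ; `s` consists of the half-edges on all other edges
  have n1 : τ b ≠ a := fun e => hn (by rw [← e, hτ])
  have n2 : τ a ≠ τ b := fun e => hab (by rw [← hτ a, e, hτ])
  have hcl : ∀ {h}, h ≠ a ∧ h ≠ b ∧ h ≠ τ a ∧ h ≠ τ b → τ h ≠ a ∧ τ h ≠ b := by
    rintro h ⟨m1, m2, m3, m4⟩
    exact ⟨fun e => m3 (by rw [← e, hτ]), fun e => m4 (by rw [← e, hτ])⟩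
  set s : Finset H := Finset.univ.filter (fun h => h ≠ a ∧ h ≠ b ∧ h ≠ τ a ∧ h ≠ τ b) with hs
  have k1 : ∀ p q, edgeProd τ (Function.update (Function.update c a p) b q) =
      kappa p (c (τ a)) * kappa q (c (τ b)) * edgeProdOn s τ c := fun p q => by
    rw [edgeProd, edgeProdOn_erase hτ (Finset.mem_univ a), edgeProdOn_erase hτ (a := b)
      (by simp [hab.symm, hn.symm]), Function.update_self, Function.update_of_ne hab,
      Function.update_of_ne hn, Function.update_of_ne (hne b), Function.update_self,
      Function.update_of_ne n1, Function.update_of_ne (hne a), ← mul_assoc]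
    congr 1
    have : ((((Finset.univ.erase a).erase (τ a)).erase b).erase (τ b)) = s := by
      ext h; simp [hs]; tauto
    rw [this]
    refine edgeProdOn_congr (fun _ _ => rfl) (fun h hh => ?_) (fun h hh => ?_) <;>
      simp only [hs, Finset.mem_filter, Finset.mem_univ, true_and] at hh
    · rw [Function.update_of_ne hh.2.1, Function.update_of_ne hh.1]
    · rw [Function.update_of_ne (hcl hh).2, Function.update_of_ne (hcl hh).1]
  have k2 : ∀ p q, edgeProd τ' (Function.update (Function.update c a p) b q) =
      kappa p q * kappa (c (τ a)) (c (τ b)) * edgeProdOn s τ c := fun p q => by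
    rw [edgeProd, edgeProdOn_erase hτ' (Finset.mem_univ a), h1, edgeProdOn_erase hτ' (a := τ a)
      (by simp [hne, hn]), h2, Function.update_self, Function.update_of_ne hab,
      Function.update_self, Function.update_of_ne hn, Function.update_of_ne (hne b),
      Function.update_of_ne n1, Function.update_of_ne (hne a), ← mul_assoc]
    congr 1
    have : ((((Finset.univ.erase a).erase b).erase (τ a)).erase (τ b)) = s := by
      ext h; simp [hs]; tauto
    rw [this]
    refine edgeProdOn_congr (fun h hh => ?_) (fun h hh => ?_) (fun h hh => ?_) <;>
      simp only [hs, Finset.mem_filter, Finset.mem_univ, true_and] at hh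
    · exact h3 h hh.1 hh.2.1 hh.2.2.1 hh.2.2.2
    · rw [Function.update_of_ne hh.2.1, Function.update_of_ne hh.1]
    · rw [h3 h hh.1 hh.2.1 hh.2.2.1 hh.2.2.2, Function.update_of_ne (hcl hh).2,
        Function.update_of_ne (hcl hh).1]
  have k3 : ∀ p q, T (Function.update (Function.update c a p) b q) = T c := fun p q =>
    hT _ _ fun h m1 m2 => by rw [Function.update_of_ne m2, Function.update_of_ne m1]
  simp only [k1, k2, k3, Function.update_self, Function.update_of_ne hab, smul_smul,
    ← Finset.sum_smul]
  congr 1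
  have e1 := sum_casimir_kappa
  have e2 := sum_casimir_kappa_kappa (c (τ a)) (c (τ b))
  simp only [Fin.sum_univ_three] at e1 e2 ⊢
  linear_combination (kappa (c (τ a)) (c (τ b)) * edgeProdOn s τ c) * (e1) -
    3 * edgeProdOn s τ c * e2

open Classical in
/-- A version of `contract_join` that allows `a`, `b` to be the two ends of one edge, when joining them
creates a circular component. -/
theorem contract_join_or_circle {τ τ' : H → H} (hτ : ∀ h, τ (τ h) = h) (hne : ∀ h, τ h ≠ h)
    (hτ' : ∀ h, τ' (τ' h) = h) {a b : H} [Decidable (τ a = b)] (hab : a ≠ b)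
    (h1 : τ' a = b) (h2 : τ' (τ a) = τ b)
    (h3 : ∀ h, h ≠ a → h ≠ b → h ≠ τ a → h ≠ τ b → τ' h = τ h) {T : (H → Fin 3) → M}
    (hT : ∀ c c', (∀ h, h ≠ a → h ≠ b → c h = c' h) → T c = T c') :
    (3 : ℚ) • contract τ (fun c => casimir (c a) (c b) • T c) =
      (3 : ℚ) ^ (if τ a = b then 1 else 0) •
        contract τ' (fun c => casimir (c a) (c b) • T c) := by
  by_cases h : τ a = b
  · have : τ' = τ := by
      funext k
      by_cases ka : k = a
      · rw [ka, h1, h]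
      by_cases kb : k = b
      · rw [kb, ← h, h2, h]
      · exact h3 k ka kb (h ▸ kb) (by rw [← h, hτ]; exact ka)
    rw [this, if_pos h, pow_one]
  · rw [if_neg h, pow_zero, one_smul, contract_join hτ hne hτ' hab h h1 h2 h3 hT]

end Contraction

/-! ### The structure constants -/

/-- The integer coefficients of the tensor `b`. -/
def epsilon : Fin 3 → Fin 3 → Fin 3 → ℤ :=
  ![![![0, 0, 0], ![0, 0, 1], ![0, -1, 0]], ![![0, 0, -1], ![0, 0, 0], ![1, 0, 0]],
    ![![0, 1, 0], ![-1, 0, 0], ![0, 0, 0]]]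

theorem bCoeff_eq_epsilon (i j k : Fin 3) : bCoeff i j k = (epsilon i j k : ℚ) := by
  have h : ∀ i j k : Fin 3, (∑ σ : Equiv.Perm (Fin 3),
      if σ 0 = i ∧ σ 1 = j ∧ σ 2 = k then (Equiv.Perm.sign σ : ℤ) else 0) = epsilon i j k := by
    decide
  rw [← h i j k, bCoeff]
  push_cast
  rfl

theorem bCoeff_swap (i j k : Fin 3) : bCoeff j i k = -bCoeff i j k := by
  have h : ∀ i j k, epsilon j i k = -epsilon i j k := by decide
  rw [bCoeff_eq_epsilon, bCoeff_eq_epsilon, h, Int.cast_neg]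

theorem bCoeff_rotate (i j k : Fin 3) : bCoeff j k i = bCoeff i j k := by
  have h : ∀ i j k, epsilon j k i = epsilon i j k := by decide
  rw [bCoeff_eq_epsilon, bCoeff_eq_epsilon, h]

/-- The matrix `kappa` with integer coefficients. -/
def kappaInt : Matrix (Fin 3) (Fin 3) ℤ := !![2, 0, 0; 0, 0, 1; 0, 1, 0]

/-- Twice the matrix `casimir`, with integer coefficients. -/
def casimirInt : Matrix (Fin 3) (Fin 3) ℤ := !![1, 0, 0; 0, 0, 2; 0, 2, 0]

theorem kappa_eq_kappaInt (i j : Fin 3) : kappa i j = (kappaInt i j : ℚ) := by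
  fin_cases i <;> fin_cases j <;> simp [kappa, kappaInt]

theorem casimir_eq_casimirInt (i j : Fin 3) : casimir i j = (casimirInt i j : ℚ) / 2 := by
  fin_cases i <;> fin_cases j <;> simp [casimir, casimirInt]

/-- The tensor on an internal edge is `2` times the difference of the tensors on two parallel and
on two crossing strands. -/
theorem sum_bCoeff_kappa_bCoeff (x y z t : Fin 3) :
    ∑ p, ∑ q, kappa p q * (bCoeff x y p * bCoeff q z t) =
      2 * (casimir y z * casimir x t - casimir x z * casimir y t) := by
  have h : ∀ x y z t : Fin 3, 2 * ∑ p, ∑ q, kappaInt p q * (epsilon x y p * epsilon q z t) =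
      casimirInt y z * casimirInt x t - casimirInt x z * casimirInt y t := by
    decide +kernel
  have h' := congrArg (fun r : ℤ => (r : ℚ) / 2) (h x y z t)
  simp only [bCoeff_eq_epsilon, kappa_eq_kappaInt, casimir_eq_casimirInt]
  push_cast at h' ⊢
  linear_combination h'

/-- The Jacobi identity. -/
theorem sum_bCoeff_jacobi (x y z t : Fin 3) :
    ∑ p, ∑ q, kappa p q * (bCoeff x y p * bCoeff q z t + bCoeff z x p * bCoeff q y t +
      bCoeff y z p * bCoeff q x t) = 0 := by
  simp only [mul_add, Finset.sum_add_distrib, sum_bCoeff_kappa_bCoeff]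
  rw [casimir_comm z y, casimir_comm y x, casimir_comm z x]
  ring

/-! ### The state sum and the relations -/

namespace JacobiDiagram

variable {n : ℕ} {A : Type*} [CommRing A] [Algebra ℚ A]

/-- The coefficients of the tensor given by copies of `b` at the trivalent vertices and of
`∑ i, x_i ⊗ P j x_i` at the univalent vertices labelled `j`, before the contraction along the
edges. -/
noncomputable def vertexTensor (P : Fin n → Fin 3 → A) {V U : Type} [Fintype V] [Fintype U]
    (label : U → Fin n) (c : HalfEdge V U → Fin 3) : A :=
  (∏ v : V, bCoeff (c (Sum.inl (v, 0))) (c (Sum.inl (v, 1))) (c (Sum.inl (v, 2)))) •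
    ∏ u : U, P (label u) (c (Sum.inr u))

/-- The state sum with values in an arbitrary commutative algebra `A`, where `P j i` is the value at
a univalent vertex labelled `j` of colour `i`. -/
noncomputable def stateSum (P : Fin n → Fin 3 → A) (D : JacobiDiagram n) : A :=
  (3 : ℚ) ^ D.circles • contract D.edge (vertexTensor P D.label)

/-- `halfMap` as an equivalence. -/
def halfEquiv {V U V' U' : Type} (φ : V ≃ V') (ψ : U ≃ U') (r : V → Fin 3) :
    HalfEdge V U ≃ HalfEdge V' U' where
  toFun := halfMap φ ψ r
  invFun
    | Sum.inl p => Sum.inl (φ.symm p.1, p.2 - r (φ.symm p.1))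
    | Sum.inr u => Sum.inr (ψ.symm u)
  left_inv := by rintro (⟨v, i⟩ | u) <;> simp [halfMap]
  right_inv := by rintro (⟨v, i⟩ | u) <;> simp [halfMap]

section StateSum

variable (P : Fin n → Fin 3 → A)

theorem vertexTensor_halfMap {V U V' U' : Type} [Fintype V] [Fintype U] [Fintype V'] [Fintype U']
    (φ : V ≃ V') (ψ : U ≃ U') (r : V → Fin 3) (label : U → Fin n) (label' : U' → Fin n)
    (hl : ∀ u, label' (ψ u) = label u) (c : HalfEdge V' U' → Fin 3) :
    vertexTensor P label' c = vertexTensor P label (c ∘ halfEquiv φ ψ r) := by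
  unfold vertexTensor
  congr 1
  · rw [← Equiv.prod_comp φ]
    refine Finset.prod_congr rfl fun v _ => ?_
    simp only [Function.comp_apply, halfEquiv, Equiv.coe_fn_mk, halfMap]
    generalize r v = i
    fin_cases i
    · rfl
    · exact (bCoeff_rotate _ _ _).symm
    · exact bCoeff_rotate _ _ _
  · rw [← Equiv.prod_comp ψ]
    exact Finset.prod_congr rfl fun u _ => by rw [hl]; rfl

theorem stateSum_isIso {D E : JacobiDiagram n} (h : IsIso D E) : D.stateSum P = E.stateSum P := by
  obtain ⟨hc, φ, ψ, r, hl, he⟩ := h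
  rw [stateSum, stateSum, hc,
    contract_equiv (halfEquiv φ ψ r) he (vertexTensor_halfMap P φ ψ r D.label E.label hl)]

theorem stateSum_disjUnion (D E : JacobiDiagram n) :
    (disjUnion D E).stateSum P = D.stateSum P * E.stateSum P := by
  have h := contract_equiv sumHalf (edge_sumHalf D E) (T' := vertexTensor P (disjUnion D E).label)
    (T := fun c => vertexTensor P D.label (c ∘ Sum.inl) * vertexTensor P E.label (c ∘ Sum.inr))
    (fun c => by
      unfold vertexTensor
      rw [smul_mul_smul_comm]
      exact congrArg₂ _ (Fintype.prod_sum_type _) (Fintype.prod_sum_type _))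
  rw [contract_sum] at h
  rw [stateSum, stateSum, stateSum, smul_mul_smul_comm, ← pow_add, ← contract_mul_contract]
  exact congrArg _ h

theorem vertexTensor_of_isEmpty {V U : Type} [Fintype V] [Fintype U] [IsEmpty V] [IsEmpty U]
    (label : U → Fin n) (c : HalfEdge V U → Fin 3) : vertexTensor P label c = 1 := by
  rw [vertexTensor, Fintype.prod_empty, Fintype.prod_empty, one_smul]

theorem stateSum_empty : (empty n).stateSum P = 1 := by
  have : IsEmpty (empty n).V := inferInstanceAs (IsEmpty Empty)
  have : IsEmpty (empty n).U := inferInstanceAs (IsEmpty Empty)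
  exact (congrArg (fun x : A => (3 : ℚ) ^ (empty n).circles • x) ((contract_of_isEmpty
    (Sum.rec (fun p => Empty.elim p.1) Empty.elim) _ _ (fun _ => 0)).trans
    (vertexTensor_of_isEmpty P _ _))).trans (by simp [empty])

theorem stateSum_circle : (circle n).stateSum P = 3 := by
  have h : (circle n).stateSum P = (3 : ℚ) • (empty n).stateSum P := by
    rw [stateSum, stateSum, smul_smul]
    exact congrArg (· • _) (by norm_num [circle, empty])
  rw [h, stateSum_empty, Algebra.smul_def, map_ofNat, mul_one]

theorem stateSum_reattach (D : JacobiDiagram n) (π : Equiv.Perm D.H) :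
    (D.reattach π).stateSum P =
      (3 : ℚ) ^ D.circles • contract D.edge (fun c => vertexTensor P D.label (c ∘ π.symm)) := by
  refine congrArg _ (contract_equiv π (fun h => ?_) (fun c => ?_))
  · simp [reattach]
  · simp only [Function.comp_assoc, Equiv.self_comp_symm]
    rfl

open Classical in
/-- The AS relation. -/
theorem stateSum_flip (D : JacobiDiagram n) (v : D.V) :
    (D.flip v).stateSum P = -D.stateSum P := by
  have key : ∀ c, vertexTensor P D.label
      (c ∘ (Equiv.swap (D.half v 0) (D.half v 1)).symm) = (-1 : ℚ) • vertexTensor P D.label c := by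
    intro c
    unfold vertexTensor
    rw [smul_smul, ← Finset.mul_prod_erase _ _ (Finset.mem_univ v),
      ← Finset.mul_prod_erase _ _ (Finset.mem_univ v), ← mul_assoc]
    congr 2
    · have h2 : Equiv.swap (D.half v 0) (D.half v 1) (D.half v 2) = D.half v 2 :=
        Equiv.swap_apply_of_ne_of_ne (by simp) (by simp)
      simp only [Function.comp_apply, Equiv.symm_swap, Equiv.swap_apply_left,
        Equiv.swap_apply_right, h2]
      rw [bCoeff_swap, neg_one_mul]
    · refine Finset.prod_congr rfl fun w hw => ?_
      have hwv := Finset.ne_of_mem_erase hw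
      have h2 : ∀ i, Equiv.swap (D.half v 0) (D.half v 1) (D.half w i) = D.half w i := fun i =>
        Equiv.swap_apply_of_ne_of_ne (by simp [hwv]) (by simp [hwv])
      simp only [Function.comp_apply, Equiv.symm_swap, h2]
  rw [flip, stateSum_reattach]
  simp only [key]
  rw [contract_smul, smul_comm, neg_one_smul]
  rfl

/-- The inclusion of the half-edges of a graph with some of its trivalent vertices deleted. -/
def subtypeHalf {V : Type} (p : V → Prop) (U : Type) : HalfEdge {v : V // p v} U → HalfEdge V U :=
  Sum.map (Prod.map Subtype.val id) id

/-- Two vertices `u ≠ w` split off from the tensor of all vertices. -/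
theorem vertexTensor_eq_smul {V U : Type} [Fintype V] [Fintype U] (label : U → Fin n) {u w : V}
    (huw : u ≠ w) [Fintype {v : V // v ≠ u ∧ v ≠ w}] (c : HalfEdge V U → Fin 3) :
    vertexTensor P label c =
      (bCoeff (c (Sum.inl (u, 0))) (c (Sum.inl (u, 1))) (c (Sum.inl (u, 2))) *
        bCoeff (c (Sum.inl (w, 0))) (c (Sum.inl (w, 1))) (c (Sum.inl (w, 2)))) •
      vertexTensor P label (c ∘ subtypeHalf (fun v => v ≠ u ∧ v ≠ w) U) := by
  classical
  unfold vertexTensor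
  rw [smul_smul, ← Finset.mul_prod_erase _ _ (Finset.mem_univ u),
    ← Finset.mul_prod_erase _ _ (Finset.mem_erase.2 ⟨huw.symm, Finset.mem_univ w⟩), ← mul_assoc]
  congr 2
  refine Finset.prod_subtype _ (fun v => ?_) _
  simp [and_comm]

theorem update_comp_subtypeHalf {V U : Type} [DecidableEq (HalfEdge V U)] {p : V → Prop}
    (c : HalfEdge V U → Fin 3) {v : V} (hv : ¬ p v) (i : Fin 3) (q : Fin 3) :
    Function.update c (Sum.inl (v, i)) q ∘ subtypeHalf p U = c ∘ subtypeHalf p U := by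
  funext h
  refine Function.update_of_ne ?_ _ _
  rcases h with ⟨⟨w, hw⟩, j⟩ | h
  · intro e
    simp only [subtypeHalf, Sum.map_inl, Prod.map_apply, Sum.inl.injEq, Prod.mk.injEq] at e
    exact hv (e.1 ▸ hw)
  · exact Sum.inr_ne_inl

open Classical in
/-- The IHX relation. -/
theorem stateSum_ihx (D : JacobiDiagram n) (u w : D.V) (huw : u ≠ w)
    (he : D.edge (D.half u 2) = D.half w 0) :
    D.stateSum P + (D.reattach (D.rotation u w)).stateSum P +
      (D.reattach (D.rotation u w * D.rotation u w)).stateSum P = 0 := by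
  have n1 : ∀ i j, D.half u i ≠ D.half w j := fun i j e =>
    huw (congrArg Prod.fst (Sum.inl.inj e))
  have n2 : ∀ (v : D.V) (i j : Fin 3), i ≠ j → D.half v i ≠ D.half v j := fun v i j h e =>
    h (congrArg Prod.snd (Sum.inl.inj e))
  set ρ := (D.rotation u w).symm with hρ
  have r0 : ρ (D.half u 0) = D.half w 1 := by
    rw [hρ, Equiv.symm_apply_eq, rotation, Equiv.Perm.mul_apply, Equiv.swap_apply_right,
      Equiv.swap_apply_right]
  have r1 : ρ (D.half u 1) = D.half u 0 := by
    rw [hρ, Equiv.symm_apply_eq, rotation, Equiv.Perm.mul_apply,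
      Equiv.swap_apply_of_ne_of_ne (n2 _ _ _ (by decide)) (n1 _ _), Equiv.swap_apply_left]
  have r2 : ρ (D.half w 1) = D.half u 1 := by
    rw [hρ, Equiv.symm_apply_eq, rotation, Equiv.Perm.mul_apply, Equiv.swap_apply_left,
      Equiv.swap_apply_of_ne_of_ne (n1 _ _).symm (n1 _ _).symm]
  have r3 : ∀ h, h ≠ D.half u 0 → h ≠ D.half u 1 → h ≠ D.half w 1 → ρ h = h := by
    intro h h0 h1 h2
    rw [hρ, Equiv.symm_apply_eq, rotation, Equiv.Perm.mul_apply,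
      Equiv.swap_apply_of_ne_of_ne h1 h2, Equiv.swap_apply_of_ne_of_ne h0 h1]
  have r4 : ρ (D.half u 2) = D.half u 2 :=
    r3 _ (n2 _ _ _ (by decide)) (n2 _ _ _ (by decide)) (n1 _ _)
  have r5 : ρ (D.half w 0) = D.half w 0 :=
    r3 _ (n1 _ _).symm (n1 _ _).symm (n2 _ _ _ (by decide))
  have r6 : ρ (D.half w 2) = D.half w 2 :=
    r3 _ (n1 _ _).symm (n1 _ _).symm (n2 _ _ _ (by decide))
  have r7 : ρ ∘ subtypeHalf (fun v => v ≠ u ∧ v ≠ w) D.U = subtypeHalf _ D.U := by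
    funext h
    rcases h with ⟨⟨v, hv⟩, j⟩ | h
    · refine r3 _ ?_ ?_ ?_ <;> simp [subtypeHalf, hv.1, hv.2]
    · refine r3 _ ?_ ?_ ?_ <;> simp [subtypeHalf]
  have hρρ : (D.rotation u w * D.rotation u w).symm = ρ * ρ := rfl
  rw [stateSum_reattach, stateSum_reattach, stateSum, ← smul_add, ← smul_add, ← contract_add,
    ← contract_add, hρρ, ← hρ]
  refine smul_eq_zero_of_right _ ?_
  refine (contract_congr D.edge_edge D.edge_ne (D.half u 2) (T' := fun _ => 0) fun c => ?_).trans
    (by simp [contract])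
  have hr2 : ∀ c : D.H → Fin 3, (c ∘ ρ ∘ ρ) ∘ subtypeHalf (fun v => v ≠ u ∧ v ≠ w) D.U =
      c ∘ subtypeHalf _ D.U := fun c => by
    rw [Function.comp_assoc, Function.comp_assoc, r7, r7]
  have hr1 : ∀ c : D.H → Fin 3, (c ∘ ρ) ∘ subtypeHalf (fun v => v ≠ u ∧ v ≠ w) D.U =
      c ∘ subtypeHalf _ D.U := fun c => by
    rw [Function.comp_assoc, r7]
  simp only [vertexTensor_eq_smul P D.label huw, Equiv.Perm.coe_mul, hr1, hr2]
  simp only [he, update_comp_subtypeHalf (p := fun v => v ≠ u ∧ v ≠ w) _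
    (show ¬ (u ≠ u ∧ u ≠ w) by tauto), update_comp_subtypeHalf (p := fun v => v ≠ u ∧ v ≠ w) _
    (show ¬ (w ≠ u ∧ w ≠ w) by tauto), ← add_smul, smul_smul, ← Finset.sum_smul]
  simp only [Function.comp_apply, r0, r1, r2, r4, r5, r6, smul_zero]
  refine smul_eq_zero_of_left ?_ _
  rw [← sum_bCoeff_jacobi (c (D.half u 0)) (c (D.half u 1)) (c (D.half w 1)) (c (D.half w 2))]
  refine Finset.sum_congr rfl fun p _ => Finset.sum_congr rfl fun q _ => ?_
  simp [huw, huw.symm]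

open Classical in
theorem join_edge_right (D : JacobiDiagram n) {a b : D.H} (hab : a ≠ b) :
    (D.join a b).edge (D.edge a) = D.edge b := by
  simp only [join, reattach, Equiv.symm_swap, Equiv.swap_apply_right]
  refine Equiv.swap_apply_of_ne_of_ne (D.edge_ne b) fun e => hab ?_
  rw [← D.edge_edge a, ← e, D.edge_edge]

theorem join_edge_of_ne (D : JacobiDiagram n) {a b h : D.H} (h1 : h ≠ a) (h2 : h ≠ b)
    (h3 : h ≠ D.edge a) (h4 : h ≠ D.edge b) : (D.join a b).edge h = D.edge h :=
  D.join_other h1 h2 (fun e => h3 (by rw [← e, D.edge_edge])) fun e => h4 (by rw [← e, D.edge_edge])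

theorem subtypeHalf_injective {V : Type} (p : V → Prop) (U : Type) :
    Function.Injective (subtypeHalf p U) :=
  Sum.map_injective.2 ⟨Subtype.val_injective.prodMap Function.injective_id, Function.injective_id⟩

theorem subtypeHalf_ne {V U : Type} {p : V → Prop} {v : V} (hv : ¬ p v) (i : Fin 3)
    (h : HalfEdge {v // p v} U) : subtypeHalf p U h ≠ Sum.inl (v, i) := by
  rcases h with ⟨⟨w, hw⟩, j⟩ | h
  · intro e
    simp only [subtypeHalf, Sum.map_inl, Prod.map_apply, Sum.inl.injEq, Prod.mk.injEq] at e
    exact hv (e.1 ▸ hw)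
  · exact Sum.inr_ne_inl

/-- Deleting two vertices `u`, `w` that are joined by three edges, with Casimir tensors on these. -/
theorem contract_delete {M : Type*} [AddCommGroup M] [Module ℚ M] {V U : Type} [Fintype V]
    [Fintype U] {u w : V} (huw : u ≠ w) [Fintype {v : V // v ≠ u ∧ v ≠ w}]
    {τ : HalfEdge V U → HalfEdge V U}
    {τ' : HalfEdge {v : V // v ≠ u ∧ v ≠ w} U → HalfEdge {v : V // v ≠ u ∧ v ≠ w} U}
    (hτ : ∀ h, τ (τ h) = h) (π : Equiv.Perm (Fin 3))
    (hπ : ∀ i, τ (Sum.inl (u, i)) = Sum.inl (w, π i))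
    (hτ' : ∀ h, τ (subtypeHalf _ U h) = subtypeHalf _ U (τ' h))
    (T : (HalfEdge {v : V // v ≠ u ∧ v ≠ w} U → Fin 3) → M) :
    contract τ (fun c => (∏ i, casimir (c (Sum.inl (u, i))) (c (Sum.inl (w, π i)))) •
      T (c ∘ subtypeHalf _ U)) = (27 : ℚ) • contract τ' T := by
  let f : (Fin 3 ⊕ Fin 3) ⊕ HalfEdge {v : V // v ≠ u ∧ v ≠ w} U → HalfEdge V U :=
    Sum.elim (Sum.elim (fun i => Sum.inl (u, i)) (fun i => Sum.inl (w, π i))) (subtypeHalf _ U)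
  have hf : Function.Bijective f := by
    constructor
    · refine (Function.Injective.sumElim (fun i j e => by simpa using e)
        (fun i j e => by simpa using e) (fun i j e => huw (by simp at e; exact e.1))).sumElim
        (subtypeHalf_injective _ U) ?_
      rintro (i | i) h e
      · exact subtypeHalf_ne (by tauto) _ h e.symm
      · exact subtypeHalf_ne (by tauto) _ h e.symm
    · rintro (⟨v, i⟩ | x)
      · by_cases h1 : v = u
        · exact ⟨Sum.inl (Sum.inl i), by rw [h1]; rfl⟩
        by_cases h2 : v = w
        · exact ⟨Sum.inl (Sum.inr (π.symm i)), by simp [f, h2]⟩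
        · exact ⟨Sum.inr (Sum.inl (⟨v, h1, h2⟩, i)), rfl⟩
      · exact ⟨Sum.inr (Sum.inr x), rfl⟩
  refine (contract_equiv (Equiv.ofBijective f hf) (τ := Sum.map Sum.swap τ')
    (T := fun c => (∏ i, casimir (c (Sum.inl (Sum.inl i))) (c (Sum.inl (Sum.inr i)))) •
      T (c ∘ Sum.inr)) ?_ (fun c => rfl)).trans ((contract_sum _ _ _).trans ?_)
  rotate_left
  · simp only [Sum.elim_inl, Sum.elim_comp_inr, contract_smul, contract_smul_const,
      contract_swap_casimir]
    norm_num
  · rintro ((i | i) | h)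
    · exact hπ i
    · exact (congrArg τ (hπ i)).symm.trans (hτ _)
    · exact hτ' h

theorem subtypeHalf_delete_edge (D : JacobiDiagram n) (u w : D.V)
    (hD : ∀ h, D.At u w h → D.At u w (D.edge h)) (k : ℕ)
    (h : HalfEdge {v : D.V // v ≠ u ∧ v ≠ w} D.U) :
    D.edge (subtypeHalf _ D.U h) = subtypeHalf _ D.U ((D.delete u w hD k).edge h) := by
  have hk : ∀ h, subtypeHalf (fun v => v ≠ u ∧ v ≠ w) D.U h = (D.keep u w h).1 := by
    rintro (⟨v, i⟩ | x) <;> rfl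
  refine (congrArg D.edge (hk h)).trans (Eq.trans ?_ (hk _).symm)
  simp only [delete, Equiv.apply_symm_apply]

/-- The edges at `u` and `w` just before the two vertices are deleted in a smoothing. -/
theorem edge_join_join (D : JacobiDiagram n) {u w : D.V} (huw : u ≠ w)
    (he : D.edge (D.half u 2) = D.half w 0) {x y : Fin 3} (hxy : x ≠ y) (hx : x ≠ 2) (hy : y ≠ 2) :
    ((D.join (D.half u y) (D.half w 1)).join (D.half u x) (D.half w 2)).edge (D.half u x) =
        D.half w 2 ∧
      ((D.join (D.half u y) (D.half w 1)).join (D.half u x) (D.half w 2)).edge (D.half u y) =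
        D.half w 1 ∧
      ((D.join (D.half u y) (D.half w 1)).join (D.half u x) (D.half w 2)).edge (D.half u 2) =
        D.half w 0 := by
  have n1 : ∀ i j, D.half u i ≠ D.half w j := fun i j e =>
    huw (congrArg Prod.fst (Sum.inl.inj e))
  have n2 : ∀ (v : D.V) (i j : Fin 3), i ≠ j → D.half v i ≠ D.half v j := fun v i j h e =>
    h (congrArg Prod.snd (Sum.inl.inj e))
  set D₁ := D.join (D.half u y) (D.half w 1) with hD₁
  have a1 : D₁.edge (D.half u y) = D.half w 1 := D.join_left (n1 _ _)
  have a3 : D₁.edge (D.half u 2) = D.half w 0 := by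
    rw [← he]
    refine D.join_other (n2 _ _ _ hy.symm) (n1 _ _) ?_ ?_ <;> rw [he]
    · exact (n1 _ _).symm
    · exact n2 _ _ _ (by decide)
  set D₂ := D₁.join (D.half u x) (D.half w 2) with hD₂
  have b1 : D₂.edge (D.half u x) = D.half w 2 := D₁.join_left (n1 _ _)
  have b3 : D₂.edge (D.half u 2) = D.half w 0 := by
    rw [← a3]
    refine D₁.join_other (n2 _ _ _ hx.symm) (n1 _ _) ?_ ?_ <;> rw [a3]
    · exact (n1 _ _).symm
    · exact n2 _ _ _ (by decide)
  have b5 : D₂.edge (D.half u y) = D.half w 1 := by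
    rw [← a1]
    refine D₁.join_other (n2 _ _ _ hxy.symm) (n1 _ _) ?_ ?_ <;> rw [a1]
    · exact (n1 _ _).symm
    · exact n2 _ _ _ (by decide)
  exact ⟨b1, b5, b3⟩

theorem exists_perm_of_ne {x y : Fin 3} (hxy : x ≠ y) (hx : x ≠ 2) (hy : y ≠ 2) :
    ∃ π : Equiv.Perm (Fin 3), π x = 2 ∧ π y = 1 ∧ π 2 = 0 := by
  have : x = 0 ∧ y = 1 ∨ x = 1 ∧ y = 0 := by omega
  rcases this with ⟨rfl, rfl⟩ | ⟨rfl, rfl⟩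
  · exact ⟨Equiv.swap 0 2, by decide, by decide, by decide⟩
  · exact ⟨Equiv.addRight 1, by decide, by decide, by decide⟩

open Classical in
/-- Casimir tensors in place of the vertices `u`, `w` compute the smoothing of the edge between
them; the factor comes from the Casimir tensor on this edge, which is left out in the smoothing. -/
theorem contract_casimir_eq_smooth (D : JacobiDiagram n) (u w : D.V) (huw : u ≠ w)
    (he : D.edge (D.half u 2) = D.half w 0) (x y : Fin 3) (hxy : x ≠ y) (hx : x ≠ 2) (hy : y ≠ 2) :
    (3 : ℚ) ^ D.circles • contract D.edge (fun c =>
      (casimir (c (D.half u 2)) (c (D.half w 0)) * (casimir (c (D.half u y)) (c (D.half w 1)) *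
        casimir (c (D.half u x)) (c (D.half w 2)))) •
      vertexTensor P D.label (c ∘ subtypeHalf (fun v => v ≠ u ∧ v ≠ w) D.U)) =
    (3 : ℚ) • (D.smooth u w huw he x y hxy hx hy).stateSum P := by
  have n1 : ∀ i j, D.half u i ≠ D.half w j := fun i j e =>
    huw (congrArg Prod.fst (Sum.inl.inj e))
  have n2 : ∀ (v : D.V) (i j : Fin 3), i ≠ j → D.half v i ≠ D.half v j := fun v i j h e =>
    h (congrArg Prod.snd (Sum.inl.inj e))
  obtain ⟨e1, e2, e3⟩ := D.edge_join_join huw he hxy hx hy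
  obtain ⟨π, p1, p2, p3⟩ := exists_perm_of_ne hxy hx hy
  have hi : ∀ i, i = x ∨ i = y ∨ i = 2 := fun i => by omega
  have hprod : ∀ g : Fin 3 → ℚ, ∏ i, g i = g 2 * (g y * g x) := fun g => by
    have : (Finset.univ : Finset (Fin 3)) = {2, y, x} := by
      ext i; have := hi i; simp; tauto
    rw [this, Finset.prod_insert (by simp [hx.symm, hy.symm]), Finset.prod_insert (by simp [hxy.symm]),
      Finset.prod_singleton]
  set T : (D.H → Fin 3) → A := fun c =>
    vertexTensor P D.label (c ∘ subtypeHalf (fun v => v ≠ u ∧ v ≠ w) D.U)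
  have hTu : ∀ (i j : Fin 3) (c c' : D.H → Fin 3),
      (∀ h, h ≠ D.half u i → h ≠ D.half w j → c h = c' h) → T c = T c' := fun i j c c' h =>
    congrArg (vertexTensor P D.label) (funext fun k => h (subtypeHalf _ _ k)
      (subtypeHalf_ne (by tauto) _ _) (subtypeHalf_ne (by tauto) _ _))
  have h1 := contract_join_or_circle (H := D.H) (τ' := (D.join (D.half u y) (D.half w 1)).edge)
    D.edge_edge D.edge_ne (D.join (D.half u y) (D.half w 1)).edge_edge (n1 y 1)
    (D.join_left (n1 y 1)) (D.join_edge_right (n1 y 1)) (fun _ => D.join_edge_of_ne)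
    (T := fun c => (casimir (c (D.half u 2)) (c (D.half w 0)) *
      casimir (c (D.half u x)) (c (D.half w 2))) • T c) (fun c c' h => by
    rw [hTu _ _ c c' h, h _ (n2 _ _ _ hy.symm) (n1 _ _), h _ (n2 _ _ _ hxy) (n1 _ _),
      h _ (n1 _ _).symm (n2 _ _ _ (by decide)), h _ (n1 _ _).symm (n2 _ _ _ (by decide))])
  have h2 := contract_join_or_circle (H := D.H)
    (τ' := ((D.join (D.half u y) (D.half w 1)).join (D.half u x) (D.half w 2)).edge)
    (D.join (D.half u y) (D.half w 1)).edge_edge (D.join (D.half u y) (D.half w 1)).edge_ne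
    ((D.join (D.half u y) (D.half w 1)).join (D.half u x) (D.half w 2)).edge_edge (n1 x 2)
    ((D.join (D.half u y) (D.half w 1)).join_left (n1 x 2))
    ((D.join (D.half u y) (D.half w 1)).join_edge_right (n1 x 2))
    (fun _ => (D.join (D.half u y) (D.half w 1)).join_edge_of_ne)
    (T := fun c : D.H → Fin 3 => (casimir (c (D.half u 2)) (c (D.half w 0)) *
      casimir (c (D.half u y)) (c (D.half w 1))) • T c) (fun c c' h => by
    rw [hTu _ _ c c' h, h _ (n2 _ _ _ hx.symm) (n1 _ _), h _ (n2 _ _ _ hxy.symm) (n1 _ _),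
      h _ (n1 _ _).symm (n2 _ _ _ (by decide)), h _ (n1 _ _).symm (n2 _ _ _ (by decide))])
  have h3 := contract_delete (V := D.V) (U := D.U) huw
    (τ := ((D.join (D.half u y) (D.half w 1)).join (D.half u x) (D.half w 2)).edge)
    (τ' := (D.smooth u w huw he x y hxy hx hy).edge)
    ((D.join (D.half u y) (D.half w 1)).join (D.half u x) (D.half w 2)).edge_edge π
    (fun i => by rcases hi i with rfl | rfl | rfl <;> simp only [p1, p2, p3] <;> assumption)
    (fun h => subtypeHalf_delete_edge
      ((D.join (D.half u y) (D.half w 1)).join (D.half u x) (D.half w 2)) u w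
      (D.smooth_aux huw he x y hxy hx hy) _ h) (vertexTensor P D.label)
  simp only [hprod, p1, p2, p3] at h3
  have a1 : ∀ a b c : ℚ, b * (a * c) = a * (b * c) := fun a b c => by ring
  have a2 : ∀ a b c : ℚ, c * (a * b) = a * (b * c) := fun a b c => by ring
  simp only [smul_smul] at h1 h2
  simp only [a1] at h1
  simp only [a2] at h2
  -- each of the two joins costs a factor `3` unless it closes a circle, the deletion gives `3 ^ 3`
  have h0 : ∀ (k c₁ c₂ : ℕ) (Z₀ Z₁ Z₂ Z₃ : A), (3 : ℚ) • Z₀ = (3 : ℚ) ^ c₁ • Z₁ →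
      (3 : ℚ) • Z₁ = (3 : ℚ) ^ c₂ • Z₂ → Z₂ = (27 : ℚ) • Z₃ →
      (3 : ℚ) ^ k • Z₀ = (3 : ℚ) • (3 : ℚ) ^ (k + (c₁ + c₂)) • Z₃ := by
    intro k c₁ c₂ Z₀ Z₁ Z₂ Z₃ z₁ z₂ z₃
    have h9 : (9 : ℚ) ≠ 0 := by norm_num
    refine smul_right_injective A h9 ?_
    calc (9 : ℚ) • (3 : ℚ) ^ k • Z₀ = (3 * (3 : ℚ) ^ k) • (3 : ℚ) • Z₀ := by
          rw [smul_smul, smul_smul]; congr 1; ring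
      _ = ((3 : ℚ) ^ k * 3 ^ c₁) • (3 : ℚ) • Z₁ := by
          rw [z₁, smul_smul, smul_smul]; congr 1; ring
      _ = _ := by
          rw [z₂, z₃]; simp only [smul_smul]; congr 1; ring
  exact h0 _ _ _ _ _ _ _ h1 h2 h3

/-- The CV relation. -/
theorem stateSum_cv (D : JacobiDiagram n) (u w : D.V) (huw : u ≠ w)
    (he : D.edge (D.half u 2) = D.half w 0) :
    D.stateSum P = 2 *
      ((D.smooth u w huw he 0 1 (by decide) (by decide) (by decide)).stateSum P -
        (D.smooth u w huw he 1 0 (by decide) (by decide) (by decide)).stateSum P) := by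
  classical
  have hA := D.contract_casimir_eq_smooth P u w huw he 0 1 (by decide) (by decide) (by decide)
  have hB := D.contract_casimir_eq_smooth P u w huw he 1 0 (by decide) (by decide) (by decide)
  set T : (D.H → Fin 3) → A := fun c =>
    vertexTensor P D.label (c ∘ subtypeHalf (fun v => v ≠ u ∧ v ≠ w) D.U) with hT
  have hTu : ∀ [DecidableEq D.H] (c : D.H → Fin 3) p q, T (Function.update (Function.update c (D.half u 2) p)
      (D.half w 0) q) = T c := fun c p q => by
    rw [hT]
    exact congrArg (vertexTensor P D.label) ((update_comp_subtypeHalf _ (by tauto) _ _).trans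
      (update_comp_subtypeHalf _ (by tauto) _ _))
  -- the Casimir tensor on the edge from `u` to `w` is inserted for the comparison with the
  -- smoothings; its contraction along this edge is `3`, hence the denominators
  have key : contract D.edge (vertexTensor P D.label) = contract D.edge (fun c =>
      (2 / 3 : ℚ) • ((casimir (c (D.half u 2)) (c (D.half w 0)) *
        (casimir (c (D.half u 1)) (c (D.half w 1)) *
        casimir (c (D.half u 0)) (c (D.half w 2)))) • T c) +
      (-2 / 3 : ℚ) • ((casimir (c (D.half u 2)) (c (D.half w 0)) *
        (casimir (c (D.half u 0)) (c (D.half w 1)) *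
        casimir (c (D.half u 1)) (c (D.half w 2)))) • T c)) := by
    refine contract_congr D.edge_edge D.edge_ne (D.half u 2) fun c => ?_
    have hv : ∀ c, vertexTensor P D.label c = _ • T c := fun c => vertexTensor_eq_smul P D.label huw c
    simp only [hv, he, hTu, smul_smul, ← add_smul, ← Finset.sum_smul]
    congr 1
    have e1 := sum_bCoeff_kappa_bCoeff (c (D.half u 0)) (c (D.half u 1)) (c (D.half w 1))
      (c (D.half w 2))
    have e2 : ∀ r : ℚ, ∑ p, ∑ q, kappa p q * (casimir p q * r) = 3 * r := fun r => by
      rw [← sum_casimir_kappa, Finset.sum_mul]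
      refine Finset.sum_congr rfl fun p _ => ?_
      rw [Finset.sum_mul]
      exact Finset.sum_congr rfl fun q _ => by ring
    have e3 := e2 (casimir (c (D.half u 1)) (c (D.half w 1)) * casimir (c (D.half u 0)) (c (D.half w 2)))
    have e4 := e2 (casimir (c (D.half u 0)) (c (D.half w 1)) * casimir (c (D.half u 1)) (c (D.half w 2)))
    simp only [Fin.sum_univ_three] at e1 e3 e4
    simp [huw, huw.symm, Fin.sum_univ_three]
    linear_combination e1 - 2 / 3 * e3 + 2 / 3 * e4
  rw [stateSum, key, contract_add, contract_smul, contract_smul, smul_add, smul_comm _ (2 / 3 : ℚ),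
    smul_comm _ (-2 / 3 : ℚ), hA, hB, smul_smul, smul_smul, mul_sub, two_mul, two_mul, ← two_smul ℚ,
    ← two_smul ℚ, sub_eq_add_neg, ← neg_smul]
  norm_num

end StateSum

theorem weight_eq_stateSum (D : JacobiDiagram n) :
    D.weight = D.stateSum (fun j i => place j (sl2DualBasis i)) := by
  rw [weight, stateSum, Algebra.smul_def, map_pow, map_ofNat]
  congr 1
  unfold contract
  refine Finset.sum_congr (by congr; exact Subsingleton.elim _ _) fun c _ => ?_
  rw [vertexTensor, smul_smul, mul_comm (edgeProd _ _)]
  refine congrArg (fun q : ℚ => q • _) (congrArg _ ?_)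
  unfold edgeProd edgeProdOn
  refine Finset.prod_congr (by congr; exact Subsingleton.elim _ _) fun e _ => rfl

end JacobiDiagram

namespace JacobiDiagram

variable {n : ℕ}

/-! ### The class of a diagram -/

theorem toAlg_eq_of_isIso {D E : JacobiDiagram n} (h : IsIso D E) : D.toAlg = E.toAlg :=
  congrArg (MonoidAlgebra.of ℚ (Class n)) (Quot.sound h)

theorem toAlg_disjUnion (D E : JacobiDiagram n) : (disjUnion D E).toAlg = D.toAlg * E.toAlg :=
  map_mul (MonoidAlgebra.of ℚ (Class n)) (show Class n from Quot.mk _ D)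
    (show Class n from Quot.mk _ E)

theorem toAlg_empty : (empty n).toAlg = 1 := map_one (MonoidAlgebra.of ℚ (Class n))

theorem toBAll_eq_of_isIso {D E : JacobiDiagram n} (h : IsIso D E) : D.toBAll = E.toBAll :=
  congrArg (Ideal.Quotient.mk (idealASIHX n)) (toAlg_eq_of_isIso h)

theorem toBAll_disjUnion (D E : JacobiDiagram n) : (disjUnion D E).toBAll = D.toBAll * E.toBAll :=
  (congrArg (Ideal.Quotient.mk (idealASIHX n)) (toAlg_disjUnion D E)).trans (map_mul _ _ _)

theorem toBAll_empty : (empty n).toBAll = 1 :=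
  (congrArg (Ideal.Quotient.mk (idealASIHX n)) toAlg_empty).trans (map_one _)

theorem toBAll_flip (D : JacobiDiagram n) (v : D.V) : (D.flip v).toBAll = -D.toBAll := by
  rw [eq_neg_iff_add_eq_zero, toBAll, toBAll, ← map_add]
  exact Ideal.Quotient.eq_zero_iff_mem.2 (Ideal.subset_span (Or.inl ⟨D, v, rfl⟩))

/-- The class of a diagram in the quotient of `BAll n` by the CV relation and the circle relation. -/
noncomputable def toCV (D : JacobiDiagram n) : BAll n ⧸ idealCV n :=
  Ideal.Quotient.mk (idealCV n) D.toBAll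

theorem toCV_eq_of_isIso {D E : JacobiDiagram n} (h : IsIso D E) : D.toCV = E.toCV :=
  congrArg (Ideal.Quotient.mk (idealCV n)) (toBAll_eq_of_isIso h)

theorem toCV_disjUnion (D E : JacobiDiagram n) : (disjUnion D E).toCV = D.toCV * E.toCV :=
  (congrArg (Ideal.Quotient.mk (idealCV n)) (toBAll_disjUnion D E)).trans (map_mul _ _ _)

theorem toCV_circle : (circle n).toCV = 3 := by
  have h : (circle n).toBAll - 3 ∈ idealCV n := Ideal.subset_span (Or.inr rfl)
  rw [← Ideal.Quotient.eq_zero_iff_mem, map_sub, sub_eq_zero] at h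
  exact h.trans (map_ofNat (Ideal.Quotient.mk (idealCV n)) 3)

theorem toCV_smooth (D : JacobiDiagram n) (u w : D.V) (huw : u ≠ w)
    (he : D.edge (D.half u 2) = D.half w 0) :
    D.toCV = 2 * ((D.smooth u w huw he 0 1 (by decide) (by decide) (by decide)).toCV -
      (D.smooth u w huw he 1 0 (by decide) (by decide) (by decide)).toCV) := by
  have h := Ideal.Quotient.eq_zero_iff_mem.2
    (Ideal.subset_span (Or.inl ⟨D, u, w, huw, he, rfl⟩) : _ ∈ idealCV n)
  rw [map_sub, sub_eq_zero] at h
  refine h.trans ?_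
  rw [map_mul, map_sub, map_ofNat]
  rfl

/-! ### Reduction to diagrams without internal edges -/

theorem reattach_edge (D : JacobiDiagram n) (π : Equiv.Perm D.H) (h : D.H) :
    (D.reattach π).edge (π h) = π (D.edge h) :=
  congrArg π (congrArg D.edge (π.symm_apply_apply h))

/-- Rotating the names of the half-edges at each trivalent vertex does not change a diagram. -/
theorem isIso_reattach_halfEquiv (D : JacobiDiagram n) (r : D.V → Fin 3) :
    IsIso D (D.reattach (halfEquiv (Equiv.refl _) (Equiv.refl _) r)) :=
  ⟨rfl, Equiv.refl _, Equiv.refl _, r, fun _ => rfl, 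
    D.reattach_edge (halfEquiv (Equiv.refl D.V) (Equiv.refl D.U) r)⟩

/-- The names of the half-edges at the two ends of an edge can be chosen by rotating, at a loop only
together. -/
theorem exists_isIso_edge_half (D : JacobiDiagram n) {v w : D.V} {i j : Fin 3}
    (h : D.edge (D.half v i) = D.half w j) (i' j' : Fin 3) (hvw : v = w → i' - i = j' - j) :
    ∃ r : D.V → Fin 3, (D.reattach (halfEquiv (Equiv.refl _) (Equiv.refl _) r)).edge
      (D.half v i') = D.half w j' := by
  classical
  refine ⟨fun x => if x = v then i' - i else j' - j, ?_⟩
  set r : D.V → Fin 3 := fun x => if x = v then i' - i else j' - j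
  have h1 : halfEquiv (Equiv.refl D.V) (Equiv.refl D.U) r (D.half v i) = D.half v i' := by
    simp [halfEquiv, halfMap, r]
  have h2 : halfEquiv (Equiv.refl D.V) (Equiv.refl D.U) r (D.half w j) = D.half w j' := by
    by_cases e : w = v
    · simp [halfEquiv, halfMap, r, e, hvw e.symm]
    · simp [halfEquiv, halfMap, r, e]
  rw [← h1, ← h2, ← h]
  exact D.reattach_edge _ _

/-- A diagram with a loop at a trivalent vertex is zero, as it is not changed by reversing the cyclic
order there. -/
theorem toBAll_eq_zero_of_loop (D : JacobiDiagram n) {v : D.V} {i j : Fin 3}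
    (h : D.edge (D.half v i) = D.half v j) : D.toBAll = 0 := by
  classical
  -- in `Fin 3`, either `j = i + 1` or `i = j + 1`
  wlog hij : j = i + 1 generalizing i j
  · refine this (i := j) (j := i) (by rw [← h, D.edge_edge]) ?_
    have : i ≠ j := fun e => D.edge_ne _ (h.trans (by rw [e]))
    omega
  obtain ⟨r, hr⟩ := D.exists_isIso_edge_half h 0 1 (fun _ => by rw [hij]; abel)
  have hi := D.isIso_reattach_halfEquiv r
  set E := D.reattach (halfEquiv (Equiv.refl _) (Equiv.refl _) r) with hE
  have hr' : E.edge (E.half v 1) = E.half v 0 := by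
    rw [← E.edge_edge (E.half v 0)]
    exact congrArg _ hr.symm
  -- exchanging the two ends of the loop leaves the edges unchanged
  have hs : ∀ k : E.H, E.edge k = Equiv.swap (E.half v 0) (E.half v 1)
      (E.edge (Equiv.swap (E.half v 0) (E.half v 1) k)) := fun k => by
    by_cases k0 : k = E.half v 0
    · rw [k0, Equiv.swap_apply_left, hr', Equiv.swap_apply_left]; exact hr
    by_cases k1 : k = E.half v 1
    · rw [k1, Equiv.swap_apply_right, hr']
      exact ((congrArg _ hr).trans (Equiv.swap_apply_right _ _)).symm
    rw [Equiv.swap_apply_of_ne_of_ne k0 k1, Equiv.swap_apply_of_ne_of_ne]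
    · exact fun e => k1 (by rw [← E.edge_edge k, e]; exact hr)
    · exact fun e => k0 (by rw [← E.edge_edge k, e, hr'])
  have hf : IsIso (E.flip v) E := by
    refine ⟨rfl, Equiv.refl _, Equiv.refl _, fun _ => 0, fun _ => rfl, fun k => ?_⟩
    have h0 : ∀ k : E.H, halfMap (Equiv.refl E.V) (Equiv.refl E.U) (fun _ => 0) k = k := by
      rintro (⟨v, i⟩ | u) <;> simp [halfMap]
    refine (congrArg _ (h0 k)).trans (Eq.trans ?_ (h0 _).symm)
    refine (hs k).trans ?_
    simp only [flip, reattach, Equiv.symm_swap]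
  have h2 := (toBAll_flip E v).symm.trans (toBAll_eq_of_isIso hf)
  rw [toBAll_eq_of_isIso hi]
  have h3 : (2 : ℚ) • E.toBAll = 0 := by
    rw [two_smul]
    nth_rewrite 1 [← h2]
    exact neg_add_cancel _
  exact (smul_eq_zero_iff_right (by norm_num)).1 h3

/-- A diagram without circular components and without edges between trivalent vertices. -/
def IsScattered (D : JacobiDiagram n) : Prop :=
  D.circles = 0 ∧ ∀ v i, ∃ x : D.U, D.edge (D.half v i) = Sum.inr x

theorem three_mul_eq_smul {A : Type*} [CommRing A] [Algebra ℚ A] (x : A) : 3 * x = (3 : ℚ) • x := by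
  rw [Algebra.smul_def, map_ofNat]

theorem toCV_circles (D : JacobiDiagram n) (k : ℕ) :
    ({ D with circles := k } : JacobiDiagram n).toCV =
      (3 : ℚ) ^ k • ({ D with circles := 0 } : JacobiDiagram n).toCV := by
  induction k with
  | zero => rw [pow_zero, one_smul]
  | succ k ih =>
    have h : IsIso (disjUnion (circle n) { D with circles := k })
        ({ D with circles := k + 1 } : JacobiDiagram n) :=
      ⟨Nat.add_comm 1 k, (isIso_empty ({ D with circles := k } : JacobiDiagram n)).2⟩
    rw [← toCV_eq_of_isIso h, toCV_disjUnion, ih, toCV_circle, pow_succ', mul_smul]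
    exact three_mul_eq_smul (A := BAll n ⧸ idealCV n) _

theorem card_smooth_lt (D : JacobiDiagram n) (u w : D.V) (huw : u ≠ w)
    (he : D.edge (D.half u 2) = D.half w 0) (x y : Fin 3) (hxy : x ≠ y) (hx : x ≠ 2) (hy : y ≠ 2) :
    Fintype.card (D.smooth u w huw he x y hxy hx hy).V < Fintype.card D.V := by
  classical
  refine Fintype.card_lt_of_injective_of_notMem
    (Subtype.val : {v : D.V // v ≠ u ∧ v ≠ w} → D.V) Subtype.val_injective (b := u) ?_
  rintro ⟨v, hv⟩
  exact v.2.1 hv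

/-- The CV relation removes all edges between trivalent vertices, one after the other. -/
theorem toCV_mem_span (D : JacobiDiagram n) :
    D.toCV ∈ Submodule.span ℚ {b : BAll n ⧸ idealCV n | ∃ E : JacobiDiagram n, E.IsScattered ∧
      Fintype.card E.U = Fintype.card D.U ∧ b = E.toCV} := by
  induction hN : Fintype.card D.V using Nat.strong_induction_on generalizing D with
  | _ N ih =>
  subst hN
  by_cases h : ∃ v i w j, D.edge (D.half v i) = D.half w j
  · obtain ⟨v, i, w, j, h⟩ := h
    by_cases hvw : v = w
    · subst hvw
      rw [toCV, D.toBAll_eq_zero_of_loop h, map_zero]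
      exact zero_mem _
    · obtain ⟨r, hr⟩ := D.exists_isIso_edge_half h 2 0 (fun e => (hvw e).elim)
      rw [toCV_eq_of_isIso (D.isIso_reattach_halfEquiv r)]
      have h2 := (toCV_smooth (D.reattach _) v w hvw hr).trans (two_mul (α := BAll n ⧸ idealCV n) _)
      rw [h2]
      refine add_mem ?_ ?_ <;> refine sub_mem ?_ ?_ <;>
      exact ih _ (card_smooth_lt (D.reattach _) v w hvw hr _ _ _ _ _) _ rfl
  · have hD : ({ D with circles := 0 } : JacobiDiagram n).IsScattered := by
      refine ⟨rfl, fun v i => ?_⟩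
      rcases hk : D.edge (D.half v i) with ⟨w, j⟩ | x
      · exact (h ⟨v, i, w, j, hk⟩).elim
      · exact ⟨x, rfl⟩
    have := toCV_circles D D.circles
    rw [show D.toCV = _ from this]
    exact Submodule.smul_mem _ _ (Submodule.subset_span ⟨_, hD, rfl, rfl⟩)

end JacobiDiagram

/-! ### Trees -/

/-- A graph is acyclic if its vertices have heights such that every vertex has at most one neighbour
that is not higher: a highest vertex of a cycle would have two. -/
theorem SimpleGraph.isAcyclic_of_height {V : Type*} {G : SimpleGraph V} (f : V → ℕ)
    (hf : ∀ a b c, G.Adj a b → G.Adj a c → f b ≤ f a → f c ≤ f a → b = c) : G.IsAcyclic := by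
  classical
  intro v p hp
  obtain ⟨a, ha, hmax⟩ := p.support.toFinset.exists_max_image f ⟨v, by simp⟩
  rw [List.mem_toFinset] at ha
  have hq := hp.rotate ha
  set q := p.rotate a ha
  have hle : ∀ b ∈ q.support, f b ≤ f a := fun b hb =>
    hmax b (List.mem_toFinset.2 ((p.mem_support_rotate_iff _ ha).1 hb))
  exact hq.snd_ne_penultimate (hf a _ _ (q.adj_snd hq.not_nil) (q.adj_penultimate hq.not_nil).symm
    (hle _ (q.getVert_mem_support _)) (hle _ (q.getVert_mem_support _)))

namespace JacobiDiagram

variable {n : ℕ}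

theorem skeleton_adj_half (D : JacobiDiagram n) (v : D.V) (i : Fin 3) :
    D.skeleton.Adj (Sum.inl v) (Sum.inr (D.half v i)) :=
  (SimpleGraph.fromRel_adj _ _ _).2 ⟨Sum.inl_ne_inr, Or.inl (Or.inl ⟨v, i, rfl, rfl⟩)⟩

theorem skeleton_adj_edge (D : JacobiDiagram n) (h : D.H) :
    D.skeleton.Adj (Sum.inr h) (Sum.inr (D.edge h)) :=
  (SimpleGraph.fromRel_adj _ _ _).2
    ⟨fun e => D.edge_ne h (Sum.inr.inj e).symm, Or.inl (Or.inr ⟨h, rfl, rfl⟩)⟩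

theorem skeleton_adj_cases (D : JacobiDiagram n) {a b : D.V ⊕ D.H} (h : D.skeleton.Adj a b) :
    (∃ v i, a = Sum.inl v ∧ b = Sum.inr (D.half v i)) ∨
    (∃ v i, a = Sum.inr (D.half v i) ∧ b = Sum.inl v) ∨
    (∃ h, a = Sum.inr h ∧ b = Sum.inr (D.edge h)) := by
  rcases ((SimpleGraph.fromRel_adj _ _ _).1 h).2 with (⟨v, i, h1, h2⟩ | ⟨k, h1, h2⟩) |
    (⟨v, i, h1, h2⟩ | ⟨k, h1, h2⟩)
  · exact Or.inl ⟨v, i, h1, h2⟩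
  · exact Or.inr (Or.inr ⟨k, h1, h2⟩)
  · exact Or.inr (Or.inl ⟨v, i, h2, h1⟩)
  · exact Or.inr (Or.inr ⟨D.edge k, h2, by rw [h1, D.edge_edge]⟩)

theorem IsScattered.isOpen {D : JacobiDiagram n} (hD : D.IsScattered) : D.IsOpen := by
  refine ⟨hD.1, fun v => ?_⟩
  obtain ⟨x, hx⟩ := hD.2 v 0
  refine ⟨x, (D.skeleton_adj_half v 0).reachable.trans ?_⟩
  rw [← hx]
  exact (D.skeleton_adj_edge _).reachable

theorem IsScattered.isAcyclic {D : JacobiDiagram n} (hD : D.IsScattered) :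
    D.skeleton.IsAcyclic := by
  refine SimpleGraph.isAcyclic_of_height
    -- trivalent vertices lie below their half-edges, and these below the univalent vertices
    (Sum.elim (fun _ => 0) (Sum.elim (fun _ => 1) (fun _ => 2))) fun a b c hab hac hb hc => ?_
  rcases D.skeleton_adj_cases hab with ⟨v, i, rfl, rfl⟩ | ⟨v, i, rfl, rfl⟩ | ⟨h, rfl, rfl⟩
  · simp at hb
  · rcases D.skeleton_adj_cases hac with ⟨w, j, h1, rfl⟩ | ⟨w, j, h1, rfl⟩ | ⟨h, h1, rfl⟩
    · simp at h1
    · simp only [Sum.inr.injEq, Sum.inl.injEq, Prod.mk.injEq] at h1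
      rw [h1.1]
    · obtain ⟨x, hx⟩ := hD.2 v i
      rw [← Sum.inr.inj h1, hx] at hc
      simp at hc
  · rcases D.skeleton_adj_cases hac with ⟨w, j, h1, rfl⟩ | ⟨w, j, h1, rfl⟩ | ⟨k, h1, rfl⟩
    · simp at h1
    · obtain ⟨x, hx⟩ := hD.2 w j
      rw [Sum.inr.inj h1, hx] at hb
      simp at hb
    · rw [Sum.inr.inj h1]

theorem IsScattered.isTree {D : JacobiDiagram n} (hD : D.IsScattered) : D.IsTree :=
  ⟨hD.1, hD.isAcyclic⟩

/-! ### Splitting off components -/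

/-- The half-edges at the trivalent vertices in `p` and the univalent vertices in `q`. -/
def HalfIn {V U : Type} (p : V → Prop) (q : U → Prop) : HalfEdge V U → Prop :=
  Sum.elim (fun x => p x.1) q

/-- The inclusion of the half-edges at some of the vertices. -/
def halfIncl {V U : Type} (p : V → Prop) (q : U → Prop) :
    HalfEdge {v // p v} {u // q u} → HalfEdge V U :=
  Sum.map (Prod.map Subtype.val id) Subtype.val

theorem halfIncl_injective {V U : Type} (p : V → Prop) (q : U → Prop) :
    Function.Injective (halfIncl p q) :=
  Sum.map_injective.2
    ⟨Subtype.val_injective.prodMap Function.injective_id, Subtype.val_injective⟩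

theorem halfIn_halfIncl {V U : Type} {p : V → Prop} {q : U → Prop}
    (h : HalfEdge {v // p v} {u // q u}) : HalfIn p q (halfIncl p q h) := by
  rcases h with ⟨v, i⟩ | u
  · exact v.2
  · exact u.2

/-- Half-edges at the vertices in `p` and `q` as half-edges over the subtypes. -/
def halfRestrict {V U : Type} {p : V → Prop} {q : U → Prop} :
    (h : HalfEdge V U) → HalfIn p q h → HalfEdge {v // p v} {u // q u}
  | Sum.inl x, hx => Sum.inl (⟨x.1, hx⟩, x.2)
  | Sum.inr u, hu => Sum.inr ⟨u, hu⟩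

theorem halfIncl_halfRestrict {V U : Type} {p : V → Prop} {q : U → Prop} (h : HalfEdge V U)
    (hh : HalfIn p q h) : halfIncl p q (halfRestrict h hh) = h := by
  rcases h with ⟨v, i⟩ | u <;> rfl

open Classical in
/-- The part of a diagram on the trivalent vertices in `p` and the univalent vertices in `q`, when
no edge leaves this part; circular components are left out. -/
noncomputable def restrict (D : JacobiDiagram n) (p : D.V → Prop) (q : D.U → Prop)
    (hpq : ∀ h, HalfIn p q h → HalfIn p q (D.edge h)) : JacobiDiagram n where
  V := {v // p v}
  U := {u // q u}
  edge h := halfRestrict (D.edge (halfIncl p q h)) (hpq _ (halfIn_halfIncl h))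
  edge_edge h := halfIncl_injective p q (by
    rw [halfIncl_halfRestrict, halfIncl_halfRestrict, D.edge_edge])
  edge_ne h e := D.edge_ne (halfIncl p q h) (by
    rw [← halfIncl_halfRestrict (D.edge _) (hpq _ (halfIn_halfIncl h)), e])
  label u := D.label u.1
  circles := 0

theorem halfIncl_restrict_edge (D : JacobiDiagram n) (p : D.V → Prop) (q : D.U → Prop)
    (hpq : ∀ h, HalfIn p q h → HalfIn p q (D.edge h)) (h : HalfEdge {v // p v} {u // q u}) :
    halfIncl p q ((D.restrict p q hpq).edge h) = D.edge (halfIncl p q h) :=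
  halfIncl_halfRestrict _ _

theorem halfIn_compl (D : JacobiDiagram n) {p : D.V → Prop} {q : D.U → Prop}
    (hpq : ∀ h, HalfIn p q h → HalfIn p q (D.edge h)) (h : D.H)
    (hh : HalfIn (fun v => ¬ p v) (fun u => ¬ q u) h) :
    HalfIn (fun v => ¬ p v) (fun u => ¬ q u) (D.edge h) := by
  have hn : ∀ k : D.H, HalfIn (fun v => ¬ p v) (fun u => ¬ q u) k ↔ ¬ HalfIn p q k := by
    rintro (⟨v, i⟩ | u) <;> exact Iff.rfl
  rw [hn] at hh ⊢
  exact fun h' => hh (by rw [← D.edge_edge h]; exact hpq _ h')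

open Classical in
theorem isIso_disjUnion_restrict (D : JacobiDiagram n) (hD : D.circles = 0) (p : D.V → Prop)
    (q : D.U → Prop) (hpq : ∀ h, HalfIn p q h → HalfIn p q (D.edge h)) :
    IsIso (disjUnion (D.restrict p q hpq) (D.restrict _ _ (D.halfIn_compl hpq))) D := by
  refine isIso_of_sum hD.symm (Equiv.sumCompl p) (Equiv.sumCompl q) (fun _ => 0)
    (halfIncl p q) (halfIncl _ _) ?_ ?_ ?_ ?_ ?_
  · rintro (⟨v, i⟩ | u)
    · simp [halfMap, sumHalf, halfIncl]
      rfl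
    · rfl
  · rintro (⟨v, i⟩ | u)
    · simp [halfMap, sumHalf, halfIncl]
      rfl
    · rfl
  · rintro (u | u) <;> rfl
  · exact fun k => (D.halfIncl_restrict_edge p q hpq k).symm
  · exact fun k => (D.halfIncl_restrict_edge _ _ (D.halfIn_compl hpq) k).symm

theorem IsScattered.restrict {D : JacobiDiagram n} (hD : D.IsScattered) (p : D.V → Prop)
    (q : D.U → Prop) (hpq : ∀ h, HalfIn p q h → HalfIn p q (D.edge h)) :
    (D.restrict p q hpq).IsScattered := by
  refine ⟨rfl, fun v i => ?_⟩
  obtain ⟨x, hx⟩ := hD.2 v.1 i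
  have h := D.halfIncl_restrict_edge p q hpq (Sum.inl (v, i))
  rcases hk : (D.restrict p q hpq).edge (Sum.inl (v, i)) with k | y
  · have h' := h.symm.trans (congrArg (halfIncl p q) hk)
    exact absurd (hx.symm.trans h') Sum.inr_ne_inl
  · exact ⟨y, rfl⟩

/-! ### Generation by connected trees -/

theorem toBsl2_eq_of_isIso {D E : JacobiDiagram n} (h : IsIso D E) (hD : D.IsOpen) (hE : E.IsOpen) :
    D.toBsl2 hD = E.toBsl2 hE :=
  congrArg _ (Subtype.ext (toBAll_eq_of_isIso h))

theorem toBsl2_disjUnion {D E : JacobiDiagram n} (hD : D.IsOpen) (hE : E.IsOpen)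
    (hDE : (disjUnion D E).IsOpen) : (disjUnion D E).toBsl2 hDE = D.toBsl2 hD * E.toBsl2 hE :=
  congrArg (Ideal.Quotient.mk ((idealCV n).comap (BJac n).val))
    (Subtype.ext (toBAll_disjUnion D E) : _ = (⟨D.toBAll, _⟩ * ⟨E.toBAll, _⟩ : BJac n))

theorem toBsl2_empty (h : (empty n).IsOpen) : (empty n).toBsl2 h = 1 :=
  congrArg (Ideal.Quotient.mk ((idealCV n).comap (BJac n).val))
    (Subtype.ext toBAll_empty : _ = (1 : BJac n))

theorem IsScattered.disjUnion {D E : JacobiDiagram n} (hD : D.IsScattered) (hE : E.IsScattered) :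
    (disjUnion D E).IsScattered := by
  refine ⟨by rw [JacobiDiagram.disjUnion, hD.1, hE.1], ?_⟩
  rintro (v | v) i
  · obtain ⟨x, hx⟩ := hD.2 v i
    exact ⟨Sum.inl x, (edge_sumHalf D E (Sum.inl (Sum.inl (v, i)))).trans
      (congrArg (fun k => sumHalf (Sum.inl k)) hx)⟩
  · obtain ⟨x, hx⟩ := hE.2 v i
    exact ⟨Sum.inr x, (edge_sumHalf D E (Sum.inr (Sum.inl (v, i)))).trans
      (congrArg (fun k => sumHalf (Sum.inr k)) hx)⟩

/-- A scattered diagram with at least one vertex has a component that is a connected tree with a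
univalent vertex: the tripod at a trivalent vertex or, if there is none, a strut. -/
theorem IsScattered.exists_component {D : JacobiDiagram n} (hD : D.IsScattered)
    (h : Nonempty D.V ∨ Nonempty D.U) : ∃ (p : D.V → Prop) (q : D.U → Prop)
      (hpq : ∀ h, HalfIn p q h → HalfIn p q (D.edge h)),
      (∃ u, q u) ∧ (D.restrict p q hpq).IsConnectedTree := by
  by_cases hV : Nonempty D.V
  · obtain ⟨v⟩ := hV
    have hpq : ∀ h : D.H, HalfIn (· = v) (fun u => ∃ i, D.edge (D.half v i) = Sum.inr u) h →
        HalfIn (· = v) (fun u => ∃ i, D.edge (D.half v i) = Sum.inr u) (D.edge h) := by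
      rintro (⟨w, i⟩ | u) hh
      · obtain rfl : w = v := hh
        obtain ⟨x, hx⟩ := hD.2 w i
        rw [hx]
        exact ⟨i, hx⟩
      · obtain ⟨i, hi⟩ := hh
        rw [← hi, D.edge_edge]
        exact rfl
    obtain ⟨x, hx⟩ := hD.2 v 0
    refine ⟨_, _, hpq, ⟨x, 0, hx⟩, rfl, ?_, (hD.restrict _ _ hpq).isAcyclic⟩
    set T := D.restrict _ _ hpq with hT
    let r : T.V := ⟨v, rfl⟩
    refine (SimpleGraph.connected_iff_exists_forall_reachable _).2 ⟨Sum.inl r, ?_⟩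
    have h1 : ∀ i, T.skeleton.Reachable (Sum.inl r) (Sum.inr (T.half r i)) := fun i =>
      (T.skeleton_adj_half r i).reachable
    rintro (⟨w, rfl⟩ | ⟨⟨w, rfl⟩, i⟩ | ⟨u, i, hi⟩)
    · exact SimpleGraph.Reachable.refl _
    · exact h1 i
    · have he : T.edge (T.half r i) = Sum.inr ⟨u, i, hi⟩ :=
        halfIncl_injective _ _ ((D.halfIncl_restrict_edge _ _ hpq _).trans hi)
      refine (h1 i).trans ?_
      have h2 := (T.skeleton_adj_edge (T.half r i)).reachable
      rw [he] at h2
      exact h2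
  · obtain ⟨u⟩ := h.resolve_left hV
    obtain ⟨y, hy⟩ : ∃ y, D.edge (Sum.inr u) = Sum.inr y := by
      rcases D.edge (Sum.inr u) with ⟨v, _⟩ | y
      · exact (hV ⟨v⟩).elim
      · exact ⟨y, rfl⟩
    have hpq : ∀ h : D.H, HalfIn (fun _ => False) (fun x => x = u ∨ x = y) h →
        HalfIn (fun _ => False) (fun x => x = u ∨ x = y) (D.edge h) := by
      rintro (⟨w, i⟩ | x) hh
      · exact hh.elim
      · rcases hh with rfl | rfl
        · rw [hy]
          exact Or.inr rfl
        · rw [← hy, D.edge_edge]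
          exact Or.inl rfl
    refine ⟨_, _, hpq, ⟨u, Or.inl rfl⟩, rfl, ?_, (hD.restrict _ _ hpq).isAcyclic⟩
    set T := D.restrict _ _ hpq with hT
    let r : T.H := Sum.inr ⟨u, Or.inl rfl⟩
    refine (SimpleGraph.connected_iff_exists_forall_reachable _).2 ⟨Sum.inr r, ?_⟩
    rintro (⟨w, hw⟩ | ⟨⟨w, hw⟩, i⟩ | ⟨x, hx⟩)
    · exact hw.elim
    · exact hw.elim
    · rcases hx with rfl | rfl
      · exact SimpleGraph.Reachable.refl _
      · have he : T.edge r = Sum.inr ⟨x, Or.inr rfl⟩ :=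
          halfIncl_injective _ _ ((D.halfIncl_restrict_edge _ _ hpq _).trans hy)
        have h2 := (T.skeleton_adj_edge r).reachable
        rw [he] at h2
        exact h2

theorem IsScattered.toBsl2_mem_adjoin {D : JacobiDiagram n} (hD : D.IsScattered) :
    D.toBsl2 hD.isOpen ∈ Algebra.adjoin ℚ {b : Bsl2 n | ∃ (T : JacobiDiagram n) (hT : T.IsOpen),
      T.IsConnectedTree ∧ b = T.toBsl2 hT} := by
  classical
  induction hN : Fintype.card D.U using Nat.strong_induction_on generalizing D with
  | _ N ih =>
  subst hN
  by_cases h : Nonempty D.V ∨ Nonempty D.U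
  · obtain ⟨p, q, hpq, ⟨u, hu⟩, hT⟩ := hD.exists_component h
    have h1 := hD.restrict p q hpq
    have h2 := hD.restrict _ _ (D.halfIn_compl hpq)
    rw [← toBsl2_eq_of_isIso (D.isIso_disjUnion_restrict hD.1 p q hpq) (h1.disjUnion h2).isOpen,
      toBsl2_disjUnion h1.isOpen h2.isOpen]
    refine mul_mem (Algebra.subset_adjoin ⟨_, _, hT, rfl⟩) (ih _ ?_ h2 rfl)
    refine Fintype.card_lt_of_injective_of_notMem
      (Subtype.val : {u // ¬ q u} → D.U) Subtype.val_injective (b := u) ?_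
    rintro ⟨v, rfl⟩
    exact v.2 hu
  · rw [not_or, not_nonempty_iff, not_nonempty_iff] at h
    obtain ⟨_, _⟩ := h
    have he : IsIso (empty n) D := ⟨hD.1.symm, Equiv.equivOfIsEmpty Empty _,
      Equiv.equivOfIsEmpty Empty _, fun _ => 0, fun u => u.elim, fun k => by
        rcases k with ⟨v, _⟩ | u
        · exact Empty.elim v
        · exact Empty.elim u⟩
    have ho : (empty n).IsOpen := ⟨rfl, fun v => v.elim⟩
    rw [← toBsl2_eq_of_isIso he ho hD.isOpen, toBsl2_empty]
    exact one_mem _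

/-- Diagrams that agree modulo the CV and circle relations agree in `Bsl2 n`. -/
theorem injective_quotientMap : Function.Injective
    (Ideal.quotientMapₐ (R₁ := ℚ) (idealCV n) (BJac n).val le_rfl) :=
  Ideal.quotientMap_injective

theorem toBsl2_mem_span (D : JacobiDiagram n) (hD : D.IsOpen) :
    D.toBsl2 hD ∈ Submodule.span ℚ {b : Bsl2 n | ∃ (E : JacobiDiagram n) (hE : E.IsScattered),
      Fintype.card E.U = Fintype.card D.U ∧ b = E.toBsl2 hE.isOpen} := by
  set φ := (Ideal.quotientMapₐ (R₁ := ℚ) (idealCV n) (BJac n).val le_rfl).toLinearMap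
  have h := D.toCV_mem_span
  have hs : {b : BAll n ⧸ idealCV n | ∃ E : JacobiDiagram n, E.IsScattered ∧
      Fintype.card E.U = Fintype.card D.U ∧ b = E.toCV} = φ '' {b : Bsl2 n | ∃ (E : JacobiDiagram n)
      (hE : E.IsScattered), Fintype.card E.U = Fintype.card D.U ∧ b = E.toBsl2 hE.isOpen} := by
    ext b
    constructor
    · rintro ⟨E, hE, hc, rfl⟩
      exact ⟨_, ⟨E, hE, hc, rfl⟩, rfl⟩
    · rintro ⟨_, ⟨E, hE, hc, rfl⟩, rfl⟩
      exact ⟨E, hE, hc, rfl⟩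
  rw [hs, ← Submodule.map_span] at h
  obtain ⟨x, hx, hxD⟩ := h
  have : x = D.toBsl2 hD := injective_quotientMap hxD
  rwa [← this]

theorem adjoin_connectedTree_eq_top :
    Algebra.adjoin ℚ {b : Bsl2 n | ∃ (T : JacobiDiagram n) (hT : T.IsOpen),
      T.IsConnectedTree ∧ b = T.toBsl2 hT} = ⊤ := by
  set S := Algebra.adjoin ℚ {b : Bsl2 n | ∃ (T : JacobiDiagram n) (hT : T.IsOpen),
    T.IsConnectedTree ∧ b = T.toBsl2 hT}
  have hJ : ∀ (D : JacobiDiagram n) (hD : D.IsOpen), D.toBsl2 hD ∈ S := by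
    intro D hD
    have hle : Submodule.span ℚ {b : Bsl2 n | ∃ (E : JacobiDiagram n) (hE : E.IsScattered),
        Fintype.card E.U = Fintype.card D.U ∧ b = E.toBsl2 hE.isOpen} ≤
        Subalgebra.toSubmodule S := by
      rw [Submodule.span_le]
      rintro _ ⟨E, hE, -, rfl⟩
      exact hE.toBsl2_mem_adjoin
    exact hle (D.toBsl2_mem_span hD)
  clear_value S
  rw [eq_top_iff]
  rintro x -
  obtain ⟨⟨y, hy⟩, rfl⟩ := Ideal.Quotient.mk_surjective x
  induction hy using Algebra.adjoin_induction with
  | mem y hy =>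
    obtain ⟨D, hD, rfl⟩ := hy
    exact hJ D hD
  | algebraMap r => exact S.algebraMap_mem r
  | add y z hy hz h1 h2 => exact S.add_mem h1 h2
  | mul y z hy hz h1 h2 => exact S.mul_mem h1 h2

/-! ### The weight system as a homomorphism -/

section WeightSystem

variable {A : Type*} [CommRing A] [Algebra ℚ A] (P : Fin n → Fin 3 → A)

/-- The state sum as a homomorphism on the algebra of all diagrams, before taking quotients. -/
noncomputable def stateSumAlg : MonoidAlgebra ℚ (Class n) →ₐ[ℚ] A :=
  MonoidAlgebra.lift ℚ A (Class n)
    { toFun := Quot.lift (stateSum P) fun _ _ => stateSum_isIso P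
      map_one' := stateSum_empty P
      map_mul' := by
        rintro ⟨D⟩ ⟨E⟩
        exact stateSum_disjUnion P D E }

theorem stateSumAlg_toAlg (D : JacobiDiagram n) : stateSumAlg P D.toAlg = D.stateSum P :=
  MonoidAlgebra.lift_of _ _

/-- The state sum on diagrams modulo AS and IHX. -/
noncomputable def stateSumBAll : BAll n →ₐ[ℚ] A :=
  Ideal.Quotient.liftₐ (idealASIHX n) (stateSumAlg P) (by
    intro a ha
    refine (Ideal.span_le (I := RingHom.ker (stateSumAlg P))).2 ?_ ha
    rintro _ (⟨D, v, rfl⟩ | ⟨D, u, w, huw, he, rfl⟩)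
    · rw [SetLike.mem_coe, RingHom.mem_ker, map_add, stateSumAlg_toAlg, stateSumAlg_toAlg,
        stateSum_flip, neg_add_cancel]
    · rw [SetLike.mem_coe, RingHom.mem_ker, map_add, map_add, stateSumAlg_toAlg, stateSumAlg_toAlg,
        stateSumAlg_toAlg, stateSum_ihx P D u w huw he])

theorem stateSumBAll_toBAll (D : JacobiDiagram n) : stateSumBAll P D.toBAll = D.stateSum P :=
  stateSumAlg_toAlg P D

theorem stateSumBAll_eq_zero {a : BAll n} (ha : a ∈ idealCV n) : stateSumBAll P a = 0 := by
  refine (Ideal.span_le (I := RingHom.ker (stateSumBAll P))).2 ?_ ha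
  rintro _ (⟨D, u, w, huw, he, rfl⟩ | rfl)
  · rw [SetLike.mem_coe, RingHom.mem_ker, map_sub, map_mul, map_sub, map_ofNat, stateSumBAll_toBAll,
      stateSumBAll_toBAll, stateSumBAll_toBAll, stateSum_cv P D u w huw he, sub_self]
  · rw [SetLike.mem_coe, RingHom.mem_ker, map_sub, map_ofNat, stateSumBAll_toBAll, stateSum_circle,
      sub_self]

/-- The state sum on the algebra of `sl₂`-Jacobi diagrams. -/
noncomputable def stateSumBsl2 : Bsl2 n →ₐ[ℚ] A :=
  Ideal.Quotient.liftₐ _ ((stateSumBAll P).comp (BJac n).val)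
    (fun _ ha => stateSumBAll_eq_zero P ha)

theorem stateSumBsl2_toBsl2 (D : JacobiDiagram n) (hD : D.IsOpen) :
    stateSumBsl2 P (D.toBsl2 hD) = D.stateSum P :=
  stateSumBAll_toBAll P D

end WeightSystem

end JacobiDiagram

open JacobiDiagram in
theorem proposition2p3 (n : ℕ) :
    Algebra.adjoin ℚ {b : Bsl2 n | ∃ (T : JacobiDiagram n) (hT : T.IsOpen),
        T.IsConnectedTree ∧ b = T.toBsl2 hT} = ⊤ ∧
    (∀ (D : JacobiDiagram n) (hD : D.IsOpen),
      D.toBsl2 hD ∈ Submodule.span ℚ {b : Bsl2 n | ∃ (T : JacobiDiagram n) (hT : T.IsOpen),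
        T.IsTree ∧ Fintype.card T.U = Fintype.card D.U ∧ b = T.toBsl2 hT}) ∧
    (∃ W : Bsl2 n →ₐ[ℚ] STensor n,
      (∀ (D : JacobiDiagram n) (hD : D.IsOpen), W (D.toBsl2 hD) = D.weight) ∧
      ∀ W' : Bsl2 n →ₐ[ℚ] STensor n,
        (∀ (T : JacobiDiagram n) (hT : T.IsOpen), T.IsConnectedTree →
          W' (T.toBsl2 hT) = T.weight) → W' = W) := by
  have hW : ∀ (D : JacobiDiagram n) (hD : D.IsOpen),
      stateSumBsl2 (A := STensor n) (fun j i => place j (sl2DualBasis i)) (D.toBsl2 hD) =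
        D.weight := fun D hD => (stateSumBsl2_toBsl2 _ D hD).trans D.weight_eq_stateSum.symm
  refine ⟨adjoin_connectedTree_eq_top, fun D hD => ?_, stateSumBsl2 _, hW, fun W' hW' => ?_⟩
  · refine Submodule.span_mono ?_ (D.toBsl2_mem_span hD)
    rintro _ ⟨E, hE, hc, rfl⟩
    exact ⟨E, hE.isOpen, hE.isTree, hc, rfl⟩
  · refine AlgHom.ext_of_adjoin_eq_top adjoin_connectedTree_eq_top ?_
    rintro _ ⟨T, hT, hc, rfl⟩
    exact (hW' T hT hc).trans (hW T hT).symm
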